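/- Let $\Phi$ be a homogeneous Poisson point process of intensity $\lambda>0$ in the Euclidean plane (the base stations), with its Voronoi tessellation. A mobile user moves along the $x$-axis; each point of the axis lying on the common boundary of the Voronoi cells of two distinct points $X,Y\in\Phi$ is an inter-cell handover, and $X,Y$ are the base stations involved in it. The user has $2^m$ directional panels, $m\ge 1$: with $\chi$ uniformly distributed on $[0,\pi]$ and independent of $\Phi$, panel $k$ ($k=0,\dots,2^m-1$) covers, as seen from the user, the angular region $[\chi+2k\pi/2^m,\ \chi+2(k+1)\pi/2^m)$. A panel swap occurs at a handover if the two base stations involved are seen by the user within the beams of two different panels. Then the point process $\Upsilon$ of handovers on the $x$-axis has positive and finite linear intensity $\mu=\mathbb E[\#(\Upsilon\cap[0,1])]$, and the Palm probability with respect to $\Upsilon$ of a panel swap at the handover, i.e. $$p=\frac1\mu\,\mathbb E\big[\#\{Z\in\Upsilon\cap[0,1]:\ \text{a panel swap occurs at }Z\}\big],$$ is $$p=\frac{2^m}{\pi}\sin\frac{\pi}{2^m},\qquad m\ge 1.$$ In particular, for two panels ($m=1$), $p=2/\pi$. -/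

import Mathlib

open MeasureTheory ProbabilityTheory Set
open scoped ENNReal NNReal

namespace PanelSwap

noncomputable section

/-- The number of points of the configuration `φ` of points of the plane `ℂ` that lie in `B`. -/
def pointCount (φ B : Set ℂ) : ℕ∞ := (φ ∩ B).encard

/-- The random set of points `Φ` is a homogeneous Poisson point process of intensity `lam` on the
Euclidean plane `ℂ`: the numbers of points in Borel sets are random variables, the number of points
in a Borel set of finite area is Poisson distributed with mean `lam` times the area, and the
numbers of points in pairwise disjoint Borel sets are independent. -/
structure IsPoissonProcess {Ω : Type*} [MeasurableSpace Ω] (P : Measure Ω) (lam : ℝ≥0)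
    (Φ : Ω → Set ℂ) : Prop where
  measurable_count : ∀ B : Set ℂ, MeasurableSet B → Measurable fun ω => pointCount (Φ ω) B
  law_count : ∀ B : Set ℂ, MeasurableSet B → volume B < ∞ →
    P.map (fun ω => pointCount (Φ ω) B) =
      (poissonMeasure (lam * (volume B).toNNReal)).map (Nat.cast : ℕ → ℕ∞)
  indep_count : ∀ (n : ℕ) (B : Fin n → Set ℂ), (∀ i, MeasurableSet (B i)) →
    Pairwise (fun i j => Disjoint (B i) (B j)) →
    iIndepFun (fun i ω => pointCount (Φ ω) (B i)) P

/-- The σ-algebra generated by the random configuration `Φ`, that is, by its numbers of points in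
Borel sets. -/
@[reducible]
def configSigma {Ω : Type*} (Φ : Ω → Set ℂ) : MeasurableSpace Ω :=
  ⨆ (B : Set ℂ) (_ : MeasurableSet B),
    MeasurableSpace.comap (fun ω => pointCount (Φ ω) B) inferInstance

/-- The closed Voronoi cell of `x` in the configuration `φ`. -/
def voronoiCell (φ : Set ℂ) (x : ℂ) : Set ℂ := {z | ∀ y ∈ φ, dist z x ≤ dist z y}

/-- `x` and `y` are distinct points of `φ` whose Voronoi cells share the boundary point `z`. -/
def AreNeighborsAt (φ : Set ℂ) (z x y : ℂ) : Prop :=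
  x ∈ φ ∧ y ∈ φ ∧ x ≠ y ∧ z ∈ voronoiCell φ x ∧ z ∈ voronoiCell φ y

/-- The points of the `x`-axis (the path of the user), given by their abscissas, that lie on a
Voronoi cell boundary: there an inter-cell handover takes place. -/
def handovers (φ : Set ℂ) : Set ℝ := {t | ∃ x y, AreNeighborsAt φ (t : ℂ) x y}

/-- The set of points that a user at the origin sees in a direction of the angular region
`[χ + 2kπ/2^m, χ + 2(k+1)π/2^m)`: the beam of panel number `k` out of `2^m`. -/
def beam (m : ℕ) (χ : ℝ) (k : Fin (2 ^ m)) : Set ℂ :=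
  {w | ∃ r a : ℝ, 0 < r ∧
    a ∈ Ico (χ + 2 * (k : ℝ) * Real.pi / 2 ^ m) (χ + 2 * ((k : ℝ) + 1) * Real.pi / 2 ^ m) ∧
    w = r * Complex.exp (a * Complex.I)}

/-- There is a handover at the origin which involves a panel swap: the two base stations of the
handover are in the beams of two different panels of the user. -/
def SwapAtOrigin (m : ℕ) (φ : Set ℂ) (χ : ℝ) : Prop :=
  ∃ x y, AreNeighborsAt φ 0 x y ∧ ∃ k l, k ≠ l ∧ x ∈ beam m χ k ∧ y ∈ beam m χ l

/-- The configuration `φ` seen from the point of abscissa `t` of the `x`-axis. -/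
def seenFrom (t : ℝ) (φ : Set ℂ) : Set ℂ := (fun z => z - (t : ℂ)) '' φ

/-- The linear intensity of the point process of handovers: its mean number of points in
`[0, 1]`. -/
def handoverIntensity {Ω : Type*} [MeasurableSpace Ω] (P : Measure Ω) (Φ : Ω → Set ℂ) : ℝ≥0∞ :=
  ∫⁻ ω, ((handovers (Φ ω) ∩ Icc 0 1).encard : ℝ≥0∞) ∂P

/-- The Palm probability, with respect to the stationary point process of handovers on the
`x`-axis, of an event `E` that depends on the configuration `Φ` and on the variable `χ` (which
is unaffected by translations): the mean number of handovers in `[0, 1]` from which the translated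
configuration, together with `χ`, satisfies `E`, divided by the intensity. -/
def palmProb {Ω : Type*} [MeasurableSpace Ω] (P : Measure Ω) (Φ : Ω → Set ℂ) (χ : Ω → ℝ)
    (E : Set ℂ → ℝ → Prop) : ℝ≥0∞ :=
  (∫⁻ ω, ({t ∈ handovers (Φ ω) ∩ Icc 0 1 | E (seenFrom t (Φ ω)) (χ ω)}.encard : ℝ≥0∞) ∂P) /
    handoverIntensity P Φ

end

end PanelSwap

/-! A handover at abscissa `t` is almost surely an unordered pair of points of `Φ` equidistant from
`t` whose circle about `t` encloses no other point. Ordering each pair by abscissa turns the number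
of handovers in `[0, 1]`, possibly restricted by a condition on the pair and `χ`, into a count of
ordered pairs. The second order Mecke formula (`lintegral_pairSet`) makes its mean `λ²` times a
double integral over `x` and `y` of `exp (-λπr²)` times the probability over `χ` of the condition,
with `r` the common distance to `t`.

For fixed `x`, the point `y` is replaced by the pair `(t, β)`, where `y = t + r e^{iβ}` and `r = |x
- t|`; the Jacobian is `r cos β + t - x.re`. Translating `x` by `t` and integrating over `t ∈ [0,
1]` gives a factor 1. In polar coordinates `x - t = r e^{iα}` the integrand becomes `r² exp (-λπr²)
(cos β - cos α)₊` times a probability that depends only on the two directions. The mean is therefore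
`λ²` times a radial integral times an angular weight (`lintegral_handoversIn_eq`), and the Palm
probability is a ratio of two angular weights.

The angular weight of the complement of the swap set is the mean over `χ` of a sum over panels: the
weight `∫∫ (cos b - cos a)₊` of the pairs of directions in a sector of opening `d = 2π/2^m`. Turning
a sector by `π` changes the sign of both cosines and so only exchanges `a` and `b`; hence averaging
`χ` over `[0, π]` is enough, and all panels contribute equally. Since `∫₀^π |cos (s + v) - cos (s +
u)| ds = 4 |sin ((u - v)/2)|`, the integral of the sector weight is `8d - 16 sin (d/2)`
(`lintegral_sectorWeight`). Summing gives `16 - 16 (2^m/π) sin (π/2^m)` for pairs in the same panel,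
out of a total of 16.

The Mecke formula is checked on boxes `A × B × {no point in C} × T` with `A` and `B` disjoint, where
it reduces to independence of the counts in five disjoint sets. It is then extended by a π-λ
argument and a countable cover of the off-diagonal pairs. -/

namespace PanelSwap

/-! ### Configurations and void events -/

/-- The planar configurations, with the σ-algebra generated by the void events. -/
structure Config where
  /-- The set of points of the configuration. -/
  pts : Set ℂ

/-- The event that a configuration has no point in `C`. -/
def voidEvent (C : Set ℂ) : Set Config := {φ | φ.pts ∩ C = ∅}

/-- The void events of the Borel sets of finite area. -/
def voidEvents : Set (Set Config) :=
  {V | ∃ C, MeasurableSet C ∧ volume C < ∞ ∧ V = voidEvent C}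

instance : MeasurableSpace Config := MeasurableSpace.generateFrom voidEvents

lemma mem_voidEvent {C : Set ℂ} {φ : Config} : φ ∈ voidEvent C ↔ φ.pts ∩ C = ∅ := Iff.rfl

lemma voidEvent_empty : voidEvent ∅ = univ := by
  ext φ; simp [mem_voidEvent]

lemma measurableSet_voidEvent {C : Set ℂ} (hC : MeasurableSet C) (hv : volume C < ∞) :
    MeasurableSet (voidEvent C) :=
  MeasurableSpace.measurableSet_generateFrom ⟨C, hC, hv, rfl⟩

lemma voidEvent_inter (C D : Set ℂ) : voidEvent C ∩ voidEvent D = voidEvent (C ∪ D) := by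
  ext φ
  rw [mem_inter_iff, mem_voidEvent, mem_voidEvent, mem_voidEvent, inter_union_distrib_left,
    union_empty_iff]

/-- Void events are the generator of choice: they are stable under intersection and their Poisson
probabilities are plain exponentials. -/
lemma isPiSystem_voidEvents : IsPiSystem voidEvents := by
  rintro _ ⟨C, hC, hCv, rfl⟩ _ ⟨D, hD, hDv, rfl⟩ _
  exact ⟨C ∪ D, hC.union hD, measure_union_lt_top hCv hDv, voidEvent_inter C D⟩

lemma isCountablySpanning_voidEvents : IsCountablySpanning voidEvents :=
  ⟨fun _ => univ, fun _ => ⟨∅, .empty, by simp, voidEvent_empty.symm⟩, iUnion_const _⟩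

/-! ### Counting pairs in a box through counts of points -/

/-- The points `x` of `φ` in `A` such that `φ` has no other point in `A ∩ C`. -/
noncomputable def loneSet (φ A C : Set ℂ) : Set ℂ := {x | x ∈ φ ∩ A ∧ (φ \ {x}) ∩ (A ∩ C) = ∅}

/-- The number of lone points in terms of the numbers of points in `A ∩ C` and `A \ C`. -/
noncomputable def loneWeight (p : ℕ∞ × ℕ∞) : ℝ≥0∞ :=
  (if p.1 = 1 then 1 else 0) + (if p.1 = 0 then (p.2 : ℝ≥0∞) else 0)

/-- A lone point in `C` is the unique point of `A ∩ C`; a lone point outside `C` forces `A ∩ C` to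
be empty, and then every point of `A \ C` is lone. These are the two summands of `loneWeight`. -/
lemma encard_loneSet (φ A C : Set ℂ) :
    ((loneSet φ A C).encard : ℝ≥0∞) =
      loneWeight (pointCount φ (A ∩ C), pointCount φ (A \ C)) := by
  have hsplit : loneSet φ A C = (loneSet φ A C ∩ C) ∪ (loneSet φ A C \ C) :=
    (inter_union_sdiff _ _).symm
  have hd : Disjoint (loneSet φ A C ∩ C) (loneSet φ A C \ C) :=
    disjoint_sdiff_right.mono_left inter_subset_right
  rw [hsplit, encard_union_eq hd, ENat.toENNReal_add]
  simp only [loneWeight]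
  congr 1
  · by_cases h : pointCount φ (A ∩ C) = 1
    · rw [if_pos h]
      obtain ⟨x, hx⟩ := encard_eq_one.1 h
      have : loneSet φ A C ∩ C = {x} := by
        ext y
        have hy : y ∈ φ ∩ (A ∩ C) ↔ y = x := by rw [hx]; rfl
        constructor
        · rintro ⟨⟨⟨h1, h2⟩, -⟩, h3⟩
          exact hy.1 ⟨h1, h2, h3⟩
        · rintro rfl
          obtain ⟨h1, h2, h3⟩ := hy.2 rfl
          refine ⟨⟨⟨h1, h2⟩, ?_⟩, h3⟩
          rw [← inter_sdiff_right_comm, hx, sdiff_self]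
      rw [this, encard_singleton, ENat.toENNReal_one]
    · have : loneSet φ A C ∩ C = ∅ := by
        by_contra hne
        obtain ⟨x, ⟨⟨h1, h2⟩, h4⟩, h3⟩ := nonempty_iff_ne_empty.2 hne
        apply h
        rw [pointCount, encard_eq_one]
        refine ⟨x, subset_antisymm ?_ (by rintro _ rfl; exact ⟨h1, h2, h3⟩)⟩
        rw [← inter_sdiff_right_comm] at h4
        exact sdiff_eq_empty.1 h4
      rw [if_neg h, this, encard_empty, ENat.toENNReal_zero]
  · by_cases h : pointCount φ (A ∩ C) = 0
    · rw [if_pos h]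
      rw [pointCount, encard_eq_zero] at h
      rw [pointCount]
      congr 2
      ext y
      constructor
      · rintro ⟨⟨⟨h1, h2⟩, -⟩, h3⟩
        exact ⟨h1, h2, h3⟩
      · rintro ⟨h1, h2, h3⟩
        refine ⟨⟨⟨h1, h2⟩, ?_⟩, h3⟩
        rw [← inter_sdiff_right_comm, h, empty_sdiff]
    · have : loneSet φ A C \ C = ∅ := by
        by_contra hne
        obtain ⟨x, ⟨⟨h1, h2⟩, h4⟩, h3⟩ := nonempty_iff_ne_empty.2 hne
        apply h
        rw [pointCount, encard_eq_zero, ← h4, ← inter_sdiff_right_comm, sdiff_eq_left.2]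
        rw [disjoint_singleton_right]
        exact fun hx => h3 hx.2.2
      rw [if_neg h, this, encard_empty, ENat.toENNReal_zero]

/-- The pairs of distinct points of `φ` which, with the rest of the configuration and the mark `c`,
are in `S`. -/
def pairSet (φ : Set ℂ) (c : ℝ) (S : Set (ℂ × ℂ × Config × ℝ)) : Set (ℂ × ℂ) :=
  {p | p.1 ∈ φ ∧ p.2 ∈ φ ∧ p.1 ≠ p.2 ∧ (p.1, p.2, ⟨φ \ {p.1, p.2}⟩, c) ∈ S}

-- Removing `x ∈ A` and `y ∈ B` with `A`, `B` disjoint affects `A ∩ C` and `B ∩ C` separately. The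
-- emptiness of `C` after removal therefore splits into a condition on `x`, one on `y`, and one on
-- `C \ (A ∪ B)`, and the pairs form a product set.
open Classical in
lemma encard_pairSet_box (φ : Set ℂ) (c : ℝ) {A B C : Set ℂ} {T : Set ℝ} (hAB : Disjoint A B) :
    ((pairSet φ c (A ×ˢ B ×ˢ voidEvent C ×ˢ T)).encard : ℝ≥0∞) =
      loneWeight (pointCount φ (A ∩ C), pointCount φ (A \ C)) *
      loneWeight (pointCount φ (B ∩ C), pointCount φ (B \ C)) *
      (if pointCount φ (C \ (A ∪ B)) = 0 then 1 else 0) * T.indicator 1 c := by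
  have key : ∀ x ∈ φ ∩ A, ∀ y ∈ φ ∩ B, ((φ \ {x, y}) ∩ C = ∅ ↔
      (φ \ {x}) ∩ (A ∩ C) = ∅ ∧ (φ \ {y}) ∩ (B ∩ C) = ∅ ∧ φ ∩ (C \ (A ∪ B)) = ∅) := by
    rintro x ⟨-, hxA⟩ y ⟨-, hyB⟩
    have hxB : x ∉ B := disjoint_left.1 hAB hxA
    have hyA : y ∉ A := disjoint_right.1 hAB hyB
    simp only [eq_empty_iff_forall_notMem, mem_inter_iff, mem_sdiff, mem_insert_iff,
      mem_singleton_iff, mem_union]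
    constructor
    · intro h
      refine ⟨fun z hz => h z ⟨⟨hz.1.1, ?_⟩, hz.2.2⟩, fun z hz => h z ⟨⟨hz.1.1, ?_⟩, hz.2.2⟩,
        fun z hz => h z ⟨⟨hz.1, ?_⟩, hz.2.1⟩⟩
      · rintro (rfl | rfl)
        exacts [hz.1.2 rfl, hyA hz.2.1]
      · rintro (rfl | rfl)
        exacts [hxB hz.2.1, hz.1.2 rfl]
      · rintro (rfl | rfl)
        exacts [hz.2.2 (.inl hxA), hz.2.2 (.inr hyB)]
    · rintro ⟨h1, h2, h3⟩ z ⟨⟨hz, hzxy⟩, hzC⟩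
      push Not at hzxy
      by_cases hzA : z ∈ A
      · exact h1 z ⟨⟨hz, hzxy.1⟩, hzA, hzC⟩
      by_cases hzB : z ∈ B
      · exact h2 z ⟨⟨hz, hzxy.2⟩, hzB, hzC⟩
      · exact h3 z ⟨hz, hzC, fun h => h.elim hzA hzB⟩
  have hzero : pointCount φ (C \ (A ∪ B)) = 0 ↔ φ ∩ (C \ (A ∪ B)) = ∅ := encard_eq_zero
  have hmem : ∀ p : ℂ × ℂ, p ∈ pairSet φ c (A ×ˢ B ×ˢ voidEvent C ×ˢ T) ↔
      p ∈ loneSet φ A C ×ˢ loneSet φ B C ∧ φ ∩ (C \ (A ∪ B)) = ∅ ∧ c ∈ T := by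
    rintro ⟨x, y⟩
    constructor
    · rintro ⟨hx, hy, -, hxA, hyB, hv, hc⟩
      obtain ⟨h1, h2, h3⟩ := (key x ⟨hx, hxA⟩ y ⟨hy, hyB⟩).1 (mem_voidEvent.1 hv)
      exact ⟨⟨⟨⟨hx, hxA⟩, h1⟩, ⟨hy, hyB⟩, h2⟩, h3, hc⟩
    · rintro ⟨⟨⟨hx, h1⟩, hy, h2⟩, h3, hc⟩
      refine ⟨hx.1, hy.1, ?_, hx.2, hy.2, mem_voidEvent.2 ((key x hx y hy).2 ⟨h1, h2, h3⟩), hc⟩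
      exact fun h => disjoint_left.1 hAB hx.2 (show x ∈ B from (show x = y from h) ▸ hy.2)
  rw [← encard_loneSet, ← encard_loneSet, ← ENat.toENNReal_mul, ← encard_prod]
  by_cases h : φ ∩ (C \ (A ∪ B)) = ∅ ∧ c ∈ T
  · have : pairSet φ c (A ×ˢ B ×ˢ voidEvent C ×ˢ T) = loneSet φ A C ×ˢ loneSet φ B C := by
      ext p; rw [hmem]; exact and_iff_left h
    rw [this, if_pos (hzero.2 h.1), indicator_of_mem h.2]; simp
  · have : pairSet φ c (A ×ˢ B ×ˢ voidEvent C ×ˢ T) = ∅ := by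
      ext p; rw [hmem]; simp only [mem_empty_iff_false, iff_false]; exact fun hp => h hp.2
    rw [this]
    by_cases h' : φ ∩ (C \ (A ∪ B)) = ∅
    · rw [indicator_of_notMem (fun hc => h ⟨h', hc⟩)]; simp
    · rw [if_neg (fun h0 => h' (hzero.1 h0))]; simp

/-! ### Poisson counts and the Mecke formula on boxes -/

lemma lintegral_poissonMeasure_natCast (r : ℝ≥0) :
    ∫⁻ n, (n : ℝ≥0∞) ∂(poissonMeasure r) = r := by
  rw [poissonMeasure, lintegral_sum_measure]
  simp only [lintegral_smul_measure, lintegral_dirac, smul_eq_mul]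
  -- The term `n = 0` vanishes, and the shift gives `(n + 1) r^(n+1) / (n+1)! = r · r^n / n!`.
  rw [tsum_eq_zero_add' ENNReal.summable]
  have h : ∀ n : ℕ, ENNReal.ofReal (Real.exp (-r) * r ^ (n + 1) / (n + 1).factorial) *
      ((n + 1 : ℕ) : ℝ≥0∞) =
      r * ENNReal.ofReal (Real.exp (-r) * r ^ n / n.factorial) := by
    intro n
    rw [← ENNReal.ofReal_natCast, ← ENNReal.ofReal_coe_nnreal (p := r),
      ← ENNReal.ofReal_mul (by positivity), ← ENNReal.ofReal_mul (by positivity),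
      Nat.factorial_succ]
    congr 1
    push_cast
    field_simp
    ring
  simp_rw [h]
  rw [ENNReal.tsum_mul_left, ← ENNReal.ofReal_tsum_of_nonneg (fun n => by positivity)
    (hasSum_one_poissonMeasure r).summable, (hasSum_one_poissonMeasure r).tsum_eq]
  simp

/-- The mean number of points in `B` of a Poisson process of intensity `lam`. -/
noncomputable def meanCount (lam : ℝ≥0) (B : Set ℂ) : ℝ≥0 := lam * (volume B).toNNReal

lemma coe_meanCount (lam : ℝ≥0) {B : Set ℂ} (hv : volume B < ∞) :
    (meanCount lam B : ℝ≥0∞) = lam * volume B := by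
  rw [meanCount, ENNReal.coe_mul, ENNReal.coe_toNNReal hv.ne]

lemma meanCount_union (lam : ℝ≥0) {A B : Set ℂ} (hB : MeasurableSet B) (hd : Disjoint A B)
    (hA : volume A < ∞) (hBv : volume B < ∞) :
    meanCount lam (A ∪ B) = meanCount lam A + meanCount lam B := by
  rw [meanCount, measure_union hd hB, ENNReal.toNNReal_add hA.ne hBv.ne, mul_add]; rfl

namespace IsPoissonProcess

variable {Ω : Type*} [MeasurableSpace Ω] {P : Measure Ω} {lam : ℝ≥0} {Φ : Ω → Set ℂ}

lemma measure_pointCount_eq (hΦ : IsPoissonProcess P lam Φ) {B : Set ℂ} (hB : MeasurableSet B)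
    (hv : volume B < ∞) (n : ℕ) :
    P {ω | pointCount (Φ ω) B = n} = poissonMeasure (meanCount lam B) {n} := by
  have h := hΦ.law_count B hB hv
  have h1 : P {ω | pointCount (Φ ω) B = n} =
      P.map (fun ω => pointCount (Φ ω) B) {(n : ℕ∞)} := by
    rw [Measure.map_apply (hΦ.measurable_count B hB) (measurableSet_singleton _)]; rfl
  rw [h1, h, Measure.map_apply .of_discrete (measurableSet_singleton _)]
  congr 1
  ext k; simp

lemma measure_pointCount_eq_zero (hΦ : IsPoissonProcess P lam Φ) {B : Set ℂ}
    (hB : MeasurableSet B) (hv : volume B < ∞) :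
    P {ω | pointCount (Φ ω) B = 0} = ENNReal.ofReal (Real.exp (-(meanCount lam B : ℝ))) := by
  simpa [poissonMeasure_singleton] using hΦ.measure_pointCount_eq hB hv 0

lemma measure_pointCount_eq_one (hΦ : IsPoissonProcess P lam Φ) {B : Set ℂ}
    (hB : MeasurableSet B) (hv : volume B < ∞) :
    P {ω | pointCount (Φ ω) B = 1} =
      ENNReal.ofReal (Real.exp (-(meanCount lam B : ℝ))) * meanCount lam B := by
  have := hΦ.measure_pointCount_eq hB hv 1
  rw [poissonMeasure_singleton] at this
  simp only [Nat.cast_one, pow_one, Nat.factorial_one, div_one] at this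
  rw [this, ENNReal.ofReal_mul (by positivity), ENNReal.ofReal_coe_nnreal]

lemma lintegral_pointCount (hΦ : IsPoissonProcess P lam Φ) {B : Set ℂ} (hB : MeasurableSet B)
    (hv : volume B < ∞) :
    ∫⁻ ω, (pointCount (Φ ω) B : ℝ≥0∞) ∂P = meanCount lam B := by
  have h := hΦ.law_count B hB hv
  rw [← lintegral_map (f := fun n : ℕ∞ => (n : ℝ≥0∞)) .of_discrete (hΦ.measurable_count B hB), h,
    lintegral_map .of_discrete .of_discrete]
  simpa [meanCount] using lintegral_poissonMeasure_natCast (meanCount lam B)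

lemma indepFun_pointCount (hΦ : IsPoissonProcess P lam Φ) {A B : Set ℂ} (hA : MeasurableSet A)
    (hB : MeasurableSet B) (hd : Disjoint A B) :
    IndepFun (fun ω => pointCount (Φ ω) A) (fun ω => pointCount (Φ ω) B) P := by
  have h := hΦ.indep_count 2 ![A, B] (by simp [Fin.forall_fin_two, hA, hB]) (by
    intro i j hij
    fin_cases i <;> fin_cases j <;> simp_all [hd.symm])
  simpa using h.indepFun (i := 0) (j := 1) (by simp)

/-- In the application `A` and `B` are `A ∩ C` and `A \ C`. The sum of their mean counts is then the
mean count of the whole first side of the box. -/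
lemma lintegral_loneWeight (hΦ : IsPoissonProcess P lam Φ) {A B : Set ℂ} (hA : MeasurableSet A)
    (hB : MeasurableSet B) (hd : Disjoint A B) (hAv : volume A < ∞) (hBv : volume B < ∞) :
    ∫⁻ ω, loneWeight (pointCount (Φ ω) A, pointCount (Φ ω) B) ∂P =
      ENNReal.ofReal (Real.exp (-(meanCount lam A : ℝ))) * (meanCount lam A + meanCount lam B) := by
  have mA := hΦ.measurable_count A hA
  have mB := hΦ.measurable_count B hB
  have e : ∀ ω, loneWeight (pointCount (Φ ω) A, pointCount (Φ ω) B) =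
      {ω | pointCount (Φ ω) A = 1}.indicator 1 ω +
      (fun n : ℕ∞ => if n = 0 then (1 : ℝ≥0∞) else 0) (pointCount (Φ ω) A) *
        (fun n : ℕ∞ => (n : ℝ≥0∞)) (pointCount (Φ ω) B) := by
    intro ω
    simp [loneWeight, indicator_apply]
  simp_rw [e]
  have m1 : MeasurableSet {ω | pointCount (Φ ω) A = 1} := mA (measurableSet_singleton _)
  have m0 : MeasurableSet {ω | pointCount (Φ ω) A = 0} := mA (measurableSet_singleton _)
  rw [lintegral_add_left (measurable_one.indicator m1), lintegral_indicator_one m1,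
    hΦ.measure_pointCount_eq_one hA hAv]
  have hi := (hΦ.indepFun_pointCount hA hB hd).comp
    (φ := fun n : ℕ∞ => if n = 0 then (1 : ℝ≥0∞) else 0) (ψ := fun n : ℕ∞ => (n : ℝ≥0∞))
    .of_discrete .of_discrete
  have := lintegral_mul_eq_lintegral_mul_lintegral_of_indepFun
    (Measurable.comp .of_discrete mA) (Measurable.comp .of_discrete mB) hi
  simp only [Pi.mul_apply, Function.comp_apply] at this
  rw [this, hΦ.lintegral_pointCount hB hBv]
  have e2 : ∀ ω, (if pointCount (Φ ω) A = 0 then (1 : ℝ≥0∞) else 0) =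
      {ω | pointCount (Φ ω) A = 0}.indicator 1 ω := by
    intro ω; simp [indicator_apply]
  simp_rw [e2]
  rw [lintegral_indicator_one m0, hΦ.measure_pointCount_eq_zero hA hAv, mul_add]

end IsPoissonProcess

lemma measurable_loneWeight : Measurable loneWeight := .of_discrete

lemma measurable_configSigma_pointCount {Ω : Type*} (Φ : Ω → Set ℂ) {B : Set ℂ}
    (hB : MeasurableSet B) : Measurable[configSigma Φ] fun ω => pointCount (Φ ω) B :=
  Measurable.of_comap_le (le_iSup₂ (f := fun (B : Set ℂ) (_ : MeasurableSet B) =>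
    MeasurableSpace.comap (fun ω => pointCount (Φ ω) B) inferInstance) B hB)

namespace IsPoissonProcess

variable {Ω : Type*} [MeasurableSpace Ω] {P : Measure Ω} {lam : ℝ≥0} {Φ : Ω → Set ℂ}

lemma measurable_config (hΦ : IsPoissonProcess P lam Φ) :
    Measurable fun ω => (⟨Φ ω⟩ : Config) := by
  refine measurable_generateFrom ?_
  rintro _ ⟨C, hC, -, rfl⟩
  have : (fun ω => (⟨Φ ω⟩ : Config)) ⁻¹' voidEvent C = {ω | pointCount (Φ ω) C = 0} := by
    ext ω
    exact encard_eq_zero.symm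
  rw [this]
  exact hΦ.measurable_count C hC (measurableSet_singleton _)

lemma map_config_voidEvent (hΦ : IsPoissonProcess P lam Φ) {C : Set ℂ} (hC : MeasurableSet C)
    (hv : volume C < ∞) :
    P.map (fun ω => (⟨Φ ω⟩ : Config)) (voidEvent C) =
      ENNReal.ofReal (Real.exp (-(meanCount lam C : ℝ))) := by
  rw [Measure.map_apply hΦ.measurable_config (measurableSet_voidEvent hC hv),
    ← hΦ.measure_pointCount_eq_zero hC hv]
  congr 1
  ext ω
  exact encard_eq_zero.symm

open Classical in
lemma lintegral_loneWeight_mul [IsProbabilityMeasure P] (hΦ : IsPoissonProcess P lam Φ)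
    {χ : Ω → ℝ} (hχ : Measurable χ)
    (hindep : Indep (configSigma Φ) (MeasurableSpace.comap χ inferInstance) P)
    {B : Fin 5 → Set ℂ} (hB : ∀ i, MeasurableSet (B i)) (hv : ∀ i, volume (B i) < ∞)
    (hd : Pairwise fun i j => Disjoint (B i) (B j)) {T : Set ℝ} (hT : MeasurableSet T) :
    ∫⁻ ω, loneWeight (pointCount (Φ ω) (B 0), pointCount (Φ ω) (B 1)) *
      loneWeight (pointCount (Φ ω) (B 2), pointCount (Φ ω) (B 3)) *
      (if pointCount (Φ ω) (B 4) = 0 then 1 else 0) * T.indicator 1 (χ ω) ∂P =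
    (ENNReal.ofReal (Real.exp (-(meanCount lam (B 0) : ℝ))) *
        (meanCount lam (B 0) + meanCount lam (B 1))) *
      (ENNReal.ofReal (Real.exp (-(meanCount lam (B 2) : ℝ))) *
        (meanCount lam (B 2) + meanCount lam (B 3))) *
      ENNReal.ofReal (Real.exp (-(meanCount lam (B 4) : ℝ))) * P (χ ⁻¹' T) := by
  have hm : ∀ i, Measurable fun ω => pointCount (Φ ω) (B i) :=
    fun i => hΦ.measurable_count _ (hB i)
  have hI := hΦ.indep_count 5 B hB hd
  set W : ℕ∞ → ℝ≥0∞ := fun n => if n = 0 then 1 else 0 with hW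
  set U : Ω → ℝ≥0∞ := fun ω => loneWeight (pointCount (Φ ω) (B 0), pointCount (Φ ω) (B 1)) with hU
  set V : Ω → ℝ≥0∞ := fun ω => loneWeight (pointCount (Φ ω) (B 2), pointCount (Φ ω) (B 3)) with hV
  set X : Ω → ℝ≥0∞ := fun ω => W (pointCount (Φ ω) (B 4)) with hX
  have mU : Measurable U := measurable_loneWeight.comp ((hm 0).prodMk (hm 1))
  have mV : Measurable V := measurable_loneWeight.comp ((hm 2).prodMk (hm 3))
  have mW : Measurable W := .of_discrete
  have mX : Measurable X := mW.comp (hm 4)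
  have iUV : IndepFun U V P :=
    (hI.indepFun_prodMk_prodMk hm 0 1 2 3 (by decide) (by decide) (by decide) (by decide)).comp
      measurable_loneWeight measurable_loneWeight
  have iUVX : IndepFun (U * V) X P := by
    have h := hI.indepFun_finset {0, 1, 2, 3} {4} (by decide) hm
    have m1 : Measurable fun f : (({0, 1, 2, 3} : Finset (Fin 5)) → ℕ∞) =>
        loneWeight (f ⟨0, by decide⟩, f ⟨1, by decide⟩) *
          loneWeight (f ⟨2, by decide⟩, f ⟨3, by decide⟩) :=
      (measurable_loneWeight.comp ((measurable_pi_apply _).prodMk (measurable_pi_apply _))).mul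
        (measurable_loneWeight.comp ((measurable_pi_apply _).prodMk (measurable_pi_apply _)))
    have m2 : Measurable fun f : (({4} : Finset (Fin 5)) → ℕ∞) => W (f ⟨4, by decide⟩) :=
      mW.comp (measurable_pi_apply _)
    exact h.comp m1 m2
  -- The first three factors are functions of counts, hence measurable for `configSigma Φ`, which is
  -- independent of `χ`.
  have iAll : IndepFun (U * V * X) (fun ω => T.indicator (1 : ℝ → ℝ≥0∞) (χ ω)) P := by
    rw [IndepFun_iff_Indep]
    refine indep_of_indep_of_le_left (indep_of_indep_of_le_right hindep ?_) ?_
    · refine Measurable.comap_le ?_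
      exact (measurable_one.indicator hT).comp (comap_measurable χ)
    · refine Measurable.comap_le ?_
      have hc : ∀ i, Measurable[configSigma Φ] fun ω => pointCount (Φ ω) (B i) :=
        fun i => measurable_configSigma_pointCount Φ (hB i)
      exact ((measurable_loneWeight.comp ((hc 0).prodMk (hc 1))).mul
        (measurable_loneWeight.comp ((hc 2).prodMk (hc 3)))).mul (mW.comp (hc 4))
  have mT : Measurable fun ω => T.indicator (1 : ℝ → ℝ≥0∞) (χ ω) :=
    (measurable_one.indicator hT).comp hχ
  have e1 := lintegral_mul_eq_lintegral_mul_lintegral_of_indepFun mU mV iUV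
  have e2 := lintegral_mul_eq_lintegral_mul_lintegral_of_indepFun (mU.mul mV) mX iUVX
  have e3 := lintegral_mul_eq_lintegral_mul_lintegral_of_indepFun ((mU.mul mV).mul mX) mT iAll
  simp only [Pi.mul_apply] at e1 e2 e3
  rw [e3, e2, e1, hΦ.lintegral_loneWeight (hB 0) (hB 1) (hd (by decide)) (hv 0) (hv 1),
    hΦ.lintegral_loneWeight (hB 2) (hB 3) (hd (by decide)) (hv 2) (hv 3)]
  congr 2
  · rw [← hΦ.measure_pointCount_eq_zero (hB 4) (hv 4), ← lintegral_indicator_one]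
    · exact lintegral_congr fun ω => by simp [hX, hW, indicator_apply]
    · exact hm 4 (measurableSet_singleton _)
  · rw [← lintegral_indicator_one (hχ hT)]
    rfl

/-- The intensity measure of the pairs of distinct points of the process together with the rest of
the process and the mark. -/
noncomputable def _root_.PanelSwap.pairMeasure (P : Measure Ω) (lam : ℝ≥0) (Φ : Ω → Set ℂ)
    (χ : Ω → ℝ) : Measure (ℂ × ℂ × Config × ℝ) :=
  (lam • volume).prod ((lam • volume).prod
    ((P.map fun ω => (⟨Φ ω⟩ : Config)).prod (P.map χ)))

lemma lintegral_pairSet_box [IsProbabilityMeasure P] (hΦ : IsPoissonProcess P lam Φ)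
    {χ : Ω → ℝ} (hχ : Measurable χ)
    (hindep : Indep (configSigma Φ) (MeasurableSpace.comap χ inferInstance) P)
    {A B C : Set ℂ} (hA : MeasurableSet A) (hB : MeasurableSet B) (hC : MeasurableSet C)
    (hAv : volume A < ∞) (hBv : volume B < ∞) (hCv : volume C < ∞) (hd : Disjoint A B)
    {T : Set ℝ} (hT : MeasurableSet T) :
    Measurable (fun ω => ((pairSet (Φ ω) (χ ω) (A ×ˢ B ×ˢ voidEvent C ×ˢ T)).encard : ℝ≥0∞)) ∧
    ∫⁻ ω, ((pairSet (Φ ω) (χ ω) (A ×ˢ B ×ˢ voidEvent C ×ˢ T)).encard : ℝ≥0∞) ∂P =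
      pairMeasure P lam Φ χ (A ×ˢ B ×ˢ voidEvent C ×ˢ T) := by
  classical
  simp_rw [encard_pairSet_box _ _ hd]
  constructor
  · have hm : ∀ {B : Set ℂ}, MeasurableSet B → Measurable fun ω => pointCount (Φ ω) B :=
      fun h => hΦ.measurable_count _ h
    have mW : Measurable fun n : ℕ∞ => if n = 0 then (1 : ℝ≥0∞) else 0 := .of_discrete
    exact (((measurable_loneWeight.comp ((hm (hA.inter hC)).prodMk (hm (hA.diff hC)))).mul
      (measurable_loneWeight.comp ((hm (hB.inter hC)).prodMk (hm (hB.diff hC))))).mul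
      (mW.comp (hm (hC.diff (hA.union hB))))).mul ((measurable_one.indicator hT).comp hχ)
  -- The five disjoint pieces recombine: the linear factors add up to `lam * volume A` and `lam *
  -- volume B`, while the three exponents add up to the mean count of `C`.
  · have h := hΦ.lintegral_loneWeight_mul hχ hindep
      (B := ![A ∩ C, A \ C, B ∩ C, B \ C, C \ (A ∪ B)]) ?_ ?_ ?_ hT
    · refine Eq.trans h ?_
      have hAC : A ∩ C ∪ A \ C = A := inter_union_sdiff A C
      have hBC : B ∩ C ∪ B \ C = B := inter_union_sdiff B C
      have hCC : A ∩ C ∪ B ∩ C ∪ C \ (A ∪ B) = C := by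
        rw [← union_inter_distrib_right, inter_comm, inter_union_sdiff]
      have vAC : volume (A ∩ C) < ∞ := (measure_mono inter_subset_left).trans_lt hAv
      have vBC : volume (B ∩ C) < ∞ := (measure_mono inter_subset_left).trans_lt hBv
      have mA : (meanCount lam (A ∩ C) : ℝ≥0∞) + meanCount lam (A \ C) = lam * volume A := by
        rw [← coe_meanCount lam hAv, ← ENNReal.coe_add, ← meanCount_union lam (hA.diff hC)
          (disjoint_sdiff_right.mono_left inter_subset_right) vAC
          ((measure_mono sdiff_subset).trans_lt hAv), hAC]
      have mB : (meanCount lam (B ∩ C) : ℝ≥0∞) + meanCount lam (B \ C) = lam * volume B := by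
        rw [← coe_meanCount lam hBv, ← ENNReal.coe_add, ← meanCount_union lam (hB.diff hC)
          (disjoint_sdiff_right.mono_left inter_subset_right) vBC
          ((measure_mono sdiff_subset).trans_lt hBv), hBC]
      have mC : meanCount lam (A ∩ C) + meanCount lam (B ∩ C) + meanCount lam (C \ (A ∪ B)) =
          meanCount lam C := by
        rw [← meanCount_union lam (hB.inter hC) (hd.mono inter_subset_left inter_subset_left)
          vAC vBC, ← meanCount_union lam (hC.diff (hA.union hB)) _ (measure_union_lt_top vAC vBC)
          ((measure_mono sdiff_subset).trans_lt hCv), hCC]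
        rw [← union_inter_distrib_right]
        exact disjoint_sdiff_right.mono_left inter_subset_left
      simp only [Matrix.cons_val_zero, Matrix.cons_val_one, Matrix.cons_val]
      rw [mA, mB, pairMeasure, Measure.prod_prod, Measure.prod_prod, Measure.prod_prod,
        hΦ.map_config_voidEvent hC hCv, Measure.map_apply hχ hT, ← mC]
      have : ENNReal.ofReal (Real.exp (-((meanCount lam (A ∩ C) + meanCount lam (B ∩ C) +
          meanCount lam (C \ (A ∪ B)) : ℝ≥0) : ℝ))) =
          ENNReal.ofReal (Real.exp (-(meanCount lam (A ∩ C) : ℝ))) *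
          ENNReal.ofReal (Real.exp (-(meanCount lam (B ∩ C) : ℝ))) *
          ENNReal.ofReal (Real.exp (-(meanCount lam (C \ (A ∪ B)) : ℝ))) := by
        rw [← ENNReal.ofReal_mul (by positivity), ← ENNReal.ofReal_mul (by positivity),
          ← Real.exp_add, ← Real.exp_add]
        push_cast
        ring_nf
      rw [this]
      simp only [Measure.smul_apply, ENNReal.smul_def, smul_eq_mul]
      ring
    · intro i
      fin_cases i
      exacts [hA.inter hC, hA.diff hC, hB.inter hC, hB.diff hC, hC.diff (hA.union hB)]
    · intro i
      fin_cases i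
      exacts [(measure_mono inter_subset_left).trans_lt hAv,
        (measure_mono sdiff_subset).trans_lt hAv, (measure_mono inter_subset_left).trans_lt hBv,
        (measure_mono sdiff_subset).trans_lt hBv, (measure_mono sdiff_subset).trans_lt hCv]
    · have hd' : ∀ z, z ∈ A → z ∉ B := fun z hz => disjoint_left.1 hd hz
      intro i j hij
      refine disjoint_left.2 fun z => ?_
      have := hd' z
      fin_cases i <;> fin_cases j <;> simp at hij ⊢ <;> tauto

end IsPoissonProcess

/-! ### The second order Mecke formula -/

/-- The boxes whose two first sides are Borel sets, the third one a void event and the last one a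
Borel set of marks. -/
def pairBoxes : Set (Set (ℂ × ℂ × Config × ℝ)) :=
  image2 (· ×ˢ ·) {s : Set ℂ | MeasurableSet s} (image2 (· ×ˢ ·) {s : Set ℂ | MeasurableSet s}
    (image2 (· ×ˢ ·) voidEvents {s : Set ℝ | MeasurableSet s}))

lemma isPiSystem_pairBoxes : IsPiSystem pairBoxes :=
  MeasurableSpace.isPiSystem_measurableSet.prod <|
    MeasurableSpace.isPiSystem_measurableSet.prod <|
      isPiSystem_voidEvents.prod MeasurableSpace.isPiSystem_measurableSet

lemma generateFrom_pairBoxes :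
    MeasurableSpace.generateFrom pairBoxes =
      (inferInstance : MeasurableSpace (ℂ × ℂ × Config × ℝ)) := by
  have s := isCountablySpanning_voidEvents
  have sC := isCountablySpanning_measurableSet (α := ℂ)
  have sR := isCountablySpanning_measurableSet (α := ℝ)
  exact generateFrom_eq_prod MeasurableSpace.generateFrom_measurableSet
    (generateFrom_eq_prod MeasurableSpace.generateFrom_measurableSet
      (generateFrom_eq_prod rfl MeasurableSpace.generateFrom_measurableSet s sR)
      sC (s.prod sR)) sC (sC.prod (s.prod sR))

/-- For a fixed configuration and mark, the number of pairs is a countably additive function of `S`;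
this and the next lemma supply the steps of the π-λ argument. -/
lemma encard_iUnion_pairSet (φ : Set ℂ) (c : ℝ) {S : ℕ → Set (ℂ × ℂ × Config × ℝ)}
    (hS : Pairwise (Function.onFun Disjoint S)) :
    ((pairSet φ c (⋃ i, S i)).encard : ℝ≥0∞) = ∑' i, ((pairSet φ c (S i)).encard : ℝ≥0∞) := by
  have h : pairSet φ c (⋃ i, S i) = ⋃ i, pairSet φ c (S i) := by
    ext p; simp [pairSet]
  rw [h, ← ENNReal.tsum_set_one]
  simp_rw [← ENNReal.tsum_set_one (pairSet φ c _)]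
  refine ENNReal.tsum_biUnion (f := fun _ => 1) ?_
  intro i _ j _ hij
  refine disjoint_left.2 fun p hi hj => ?_
  exact disjoint_left.1 (hS hij) hi.2.2.2 hj.2.2.2

lemma encard_pairSet_add_diff (φ : Set ℂ) (c : ℝ) (R S : Set (ℂ × ℂ × Config × ℝ)) :
    ((pairSet φ c (S ∩ R)).encard : ℝ≥0∞) + (pairSet φ c (Sᶜ ∩ R)).encard =
      (pairSet φ c R).encard := by
  rw [← ENat.toENNReal_add, ← encard_union_eq]
  · congr 2
    ext p
    simp only [pairSet, mem_union, mem_ofPred_eq, mem_inter_iff, mem_compl_iff]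
    tauto
  · exact disjoint_left.2 fun p h h' => h'.2.2.2.1 h.2.2.2.1

namespace IsPoissonProcess

variable {Ω : Type*} [MeasurableSpace Ω] {P : Measure Ω} {lam : ℝ≥0}
  {Φ : Ω → Set ℂ} {χ : Ω → ℝ}

/-- A π-λ induction on `S`. Restricting to one box of finite area keeps the means finite, which
legitimates the subtraction for complements; disjoint sides make the box computation available. -/
lemma lintegral_pairSet_inter_box [IsProbabilityMeasure P] (hΦ : IsPoissonProcess P lam Φ) (hχ : Measurable χ)
    (hindep : Indep (configSigma Φ) (MeasurableSpace.comap χ inferInstance) P)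
    {A B : Set ℂ} (hA : MeasurableSet A) (hB : MeasurableSet B)
    (hAv : volume A < ∞) (hBv : volume B < ∞) (hd : Disjoint A B)
    {S : Set (ℂ × ℂ × Config × ℝ)} (hS : MeasurableSet S) :
    AEMeasurable
      (fun ω => ((pairSet (Φ ω) (χ ω) (S ∩ A ×ˢ B ×ˢ univ)).encard : ℝ≥0∞)) P ∧
    ∫⁻ ω, ((pairSet (Φ ω) (χ ω) (S ∩ A ×ˢ B ×ˢ univ)).encard : ℝ≥0∞) ∂P =
      pairMeasure P lam Φ χ (S ∩ A ×ˢ B ×ˢ univ) := by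
  have hR : (A ×ˢ B ×ˢ univ : Set (ℂ × ℂ × Config × ℝ)) =
      A ×ˢ B ×ˢ voidEvent ∅ ×ˢ univ := by
    rw [voidEvent_empty, univ_prod_univ]
  have hbox := hΦ.lintegral_pairSet_box hχ hindep hA hB .empty hAv hBv (by simp) hd .univ
  rw [← hR] at hbox
  have mR : MeasurableSet (A ×ˢ B ×ˢ univ : Set (ℂ × ℂ × Config × ℝ)) :=
    hA.prod (hB.prod .univ)
  have hfin : pairMeasure P lam Φ χ (A ×ˢ B ×ˢ univ) ≠ ∞ := by
    have := Measure.isProbabilityMeasure_map (μ := P) hΦ.measurable_config.aemeasurable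
    have := Measure.isProbabilityMeasure_map (μ := P) hχ.aemeasurable
    rw [pairMeasure, Measure.prod_prod, Measure.prod_prod, measure_univ, mul_one]
    simp only [Measure.smul_apply, ENNReal.smul_def, smul_eq_mul]
    finiteness
  induction S, hS using MeasurableSpace.induction_on_inter generateFrom_pairBoxes.symm
    isPiSystem_pairBoxes with
  | empty => simp [pairSet]
  | basic t ht =>
    obtain ⟨B1, hB1, _, ⟨B2, hB2, _, ⟨_, ⟨C, hC, hCv, rfl⟩, T, hT, rfl⟩, rfl⟩, rfl⟩ := ht
    have : (B1 ×ˢ B2 ×ˢ voidEvent C ×ˢ T) ∩ A ×ˢ B ×ˢ univ =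
        (B1 ∩ A) ×ˢ (B2 ∩ B) ×ˢ voidEvent C ×ˢ T := by
      rw [prod_inter_prod, prod_inter_prod, inter_univ]
    dsimp only
    rw [this]
    have h := hΦ.lintegral_pairSet_box hχ hindep (MeasurableSet.inter (s₁ := B1) hB1 hA)
      (MeasurableSet.inter (s₁ := B2) hB2 hB) hC
      ((measure_mono inter_subset_right).trans_lt hAv)
      ((measure_mono inter_subset_right).trans_lt hBv) hCv
      (hd.mono inter_subset_right inter_subset_right) hT
    exact ⟨h.1.aemeasurable, h.2⟩
  | compl t ht ih =>
    have hadd := fun ω => encard_pairSet_add_diff (Φ ω) (χ ω) (A ×ˢ B ×ˢ univ) t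
    have hf : ∀ᵐ ω ∂P, ((pairSet (Φ ω) (χ ω) (A ×ˢ B ×ˢ univ)).encard : ℝ≥0∞) < ∞ :=
      ae_lt_top hbox.1 (hbox.2 ▸ hfin)
    -- The subtraction is valid only where the count is finite, that is, almost surely. This is why
    -- the induction carries `AEMeasurable` and not `Measurable`.
    have heq : (fun ω => ((pairSet (Φ ω) (χ ω) (tᶜ ∩ A ×ˢ B ×ˢ univ)).encard : ℝ≥0∞)) =ᵐ[P]
        fun ω => ((pairSet (Φ ω) (χ ω) (A ×ˢ B ×ˢ univ)).encard : ℝ≥0∞) -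
          (pairSet (Φ ω) (χ ω) (t ∩ A ×ˢ B ×ˢ univ)).encard := by
      filter_upwards [hf] with ω hω
      rw [← hadd ω] at hω ⊢
      rw [ENNReal.add_sub_cancel_left ((le_self_add.trans_lt hω).ne)]
    have hle : ∫⁻ ω, ((pairSet (Φ ω) (χ ω) (t ∩ A ×ˢ B ×ˢ univ)).encard : ℝ≥0∞) ∂P ≠ ∞ := by
      rw [ih.2]
      exact measure_ne_top_of_subset inter_subset_right hfin
    refine ⟨(hbox.1.aemeasurable.sub ih.1).congr heq.symm, ?_⟩
    rw [lintegral_congr_ae heq, lintegral_sub' ih.1 hle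
      (.of_forall fun ω => (hadd ω) ▸ le_self_add), hbox.2, ih.2,
      ← measure_sdiff inter_subset_right (ht.inter mR).nullMeasurableSet
        (measure_ne_top_of_subset inter_subset_right hfin)]
    congr 1
    ext p
    simp only [mem_sdiff, mem_inter_iff, mem_compl_iff]
    tauto
  | iUnion f hfd hfm ih =>
    simp_rw [iUnion_inter]
    have hd' : Pairwise (Function.onFun Disjoint fun i => f i ∩ A ×ˢ B ×ˢ univ) :=
      fun i j hij => (hfd hij).mono inter_subset_left inter_subset_left
    simp_rw [encard_iUnion_pairSet _ _ hd']
    refine ⟨AEMeasurable.tsum fun i => (ih i).1, ?_⟩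
    rw [lintegral_tsum fun i => (ih i).1, measure_iUnion hd' fun i => (hfm i).inter mR]
    exact tsum_congr fun i => (ih i).2

/-- The second order Campbell–Mecke formula for a Poisson process with an independent mark. -/
theorem lintegral_pairSet [IsProbabilityMeasure P] (hΦ : IsPoissonProcess P lam Φ) (hχ : Measurable χ)
    (hindep : Indep (configSigma Φ) (MeasurableSpace.comap χ inferInstance) P)
    {S : Set (ℂ × ℂ × Config × ℝ)} (hS : MeasurableSet S) (hne : ∀ s ∈ S, s.1 ≠ s.2.1) :
    AEMeasurable (fun ω => ((pairSet (Φ ω) (χ ω) S).encard : ℝ≥0∞)) P ∧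
    ∫⁻ ω, ((pairSet (Φ ω) (χ ω) S).encard : ℝ≥0∞) ∂P = pairMeasure P lam Φ χ S := by
  obtain ⟨e, he⟩ := exists_surjective_nat (ℕ × ℕ × ℕ)
  -- The index `j` encodes a centre in a countable dense set, a radius `1/(k+1)`, and the radius of
  -- a large ball about 0 that confines the second point.
  let A : ℕ → Set ℂ := fun j =>
    Metric.ball (TopologicalSpace.denseSeq ℂ (e j).1) (1 / ((e j).2.1 + 1))
  let B : ℕ → Set ℂ := fun j => Metric.ball 0 (e j).2.2 \ A j
  let R : ℕ → Set (ℂ × ℂ × Config × ℝ) := fun j => A j ×ˢ B j ×ˢ univ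
  have mA : ∀ j, MeasurableSet (A j) := fun j => measurableSet_ball
  have mB : ∀ j, MeasurableSet (B j) := fun j => measurableSet_ball.diff (mA j)
  have mR : ∀ j, MeasurableSet (R j) := fun j => (mA j).prod ((mB j).prod .univ)
  have hcover : S ⊆ ⋃ j, R j := by
    rintro ⟨x, y, s⟩ hs
    have hxy : x ≠ y := hne _ hs
    -- If `x` is within `1/(k+1) < dist x y / 2` of the centre, then `y` is farther than `1/(k+1)`
    -- from it, so `y` lies outside `A j`.
    have hpos : 0 < dist x y / 2 := by have := dist_pos.2 hxy; positivity
    obtain ⟨k, hk⟩ := exists_nat_one_div_lt hpos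
    obtain ⟨i, hi⟩ := (TopologicalSpace.denseRange_denseSeq ℂ).exists_dist_lt x
      (ε := 1 / ((k : ℝ) + 1)) (by positivity)
    obtain ⟨n, hn⟩ := exists_nat_gt ‖y‖
    obtain ⟨j, hj⟩ := he (i, k, n)
    refine mem_iUnion.2 ⟨j, ?_, ⟨?_, ?_⟩, trivial⟩
    · simpa [A, hj] using hi
    · simpa [hj] using hn
    · simp only [A, hj, Metric.mem_ball, not_lt]
      have := dist_triangle_right x y (TopologicalSpace.denseSeq ℂ i)
      linarith
  -- The pieces `disjointed R j` are not boxes, so they are absorbed into the measurable set `S`,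
  -- and the formula is applied inside the box `R j`.
  have hSd : S = ⋃ j, (S ∩ disjointed R j) ∩ R j := by
    have : ∀ j, (S ∩ disjointed R j) ∩ R j = S ∩ disjointed R j :=
      fun j => inter_eq_left.2 (inter_subset_right.trans (disjointed_subset R j))
    simp_rw [this]
    rw [← inter_iUnion, iUnion_disjointed, inter_eq_left.2 hcover]
  have hdj : Pairwise (Function.onFun Disjoint fun j => (S ∩ disjointed R j) ∩ R j) :=
    fun i j hij => (disjoint_disjointed R hij).mono
      (inter_subset_left.trans inter_subset_right) (inter_subset_left.trans inter_subset_right)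
  have mS : ∀ j, MeasurableSet (S ∩ disjointed R j) :=
    fun j => hS.inter (MeasurableSet.disjointed mR j)
  have h := fun j => hΦ.lintegral_pairSet_inter_box hχ hindep (mA j) (mB j)
    measure_ball_lt_top ((measure_mono sdiff_subset).trans_lt measure_ball_lt_top)
    disjoint_sdiff_right (mS j)
  rw [hSd]
  simp_rw [encard_iUnion_pairSet _ _ hdj]
  refine ⟨AEMeasurable.tsum fun j => (h j).1, ?_⟩
  rw [lintegral_tsum fun j => (h j).1, measure_iUnion hdj fun j => (mS j).inter (mR j)]
  exact tsum_congr fun j => (h j).2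

end IsPoissonProcess

/-! ### Handovers as pairs of points -/

/-- The abscissa of the point of the `x`-axis which is equidistant from `x` and `y`. -/
noncomputable def axisCenter (x y : ℂ) : ℝ :=
  (y.re ^ 2 + y.im ^ 2 - (x.re ^ 2 + x.im ^ 2)) / (2 * (y.re - x.re))

lemma dist_ofReal_sq (t : ℝ) (x : ℂ) : dist (t : ℂ) x ^ 2 = (t - x.re) ^ 2 + x.im ^ 2 := by
  rw [Complex.dist_eq, ← Complex.normSq_eq_norm_sq, Complex.normSq_apply]
  simp; ring

lemma dist_eq_dist_iff {x y : ℂ} (h : x.re ≠ y.re) (t : ℝ) :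
    dist (t : ℂ) x = dist (t : ℂ) y ↔ t = axisCenter x y := by
  have h' : y.re - x.re ≠ 0 := sub_ne_zero.2 h.symm
  rw [← sq_eq_sq₀ dist_nonneg dist_nonneg, dist_ofReal_sq, dist_ofReal_sq, axisCenter,
    eq_div_iff (by simpa using h')]
  constructor <;> intro h <;> linarith

lemma dist_axisCenter {x y : ℂ} (h : x.re ≠ y.re) :
    dist (axisCenter x y : ℂ) x = dist (axisCenter x y : ℂ) y := (dist_eq_dist_iff h _).2 rfl

lemma measurable_axisCenter : Measurable fun p : ℂ × ℂ => axisCenter p.1 p.2 := by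
  unfold axisCenter
  fun_prop

/-- The ball moves with the pair of points, so a single void event does not suffice. An open ball is
the union of the small balls with dense centres and radii `1/(k+1)` that fit inside it, and it is
void exactly when all of these are. -/
lemma measurableSet_void_ball :
    MeasurableSet {p : ℂ × ℝ × Config | p.2.2 ∈ voidEvent (Metric.ball p.1 p.2.1)} := by
  have h : {p : ℂ × ℝ × Config | p.2.2 ∈ voidEvent (Metric.ball p.1 p.2.1)} =
      ⋂ (i : ℕ) (k : ℕ), ({p | 1 / ((k : ℝ) + 1) + dist (TopologicalSpace.denseSeq ℂ i) p.1 ≤ p.2.1}ᶜ ∪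
        {p | p.2.2 ∈ voidEvent (Metric.ball (TopologicalSpace.denseSeq ℂ i) (1 / ((k : ℝ) + 1)))}) := by
    ext ⟨c, r, φ⟩
    simp only [mem_iInter, mem_union, mem_compl_iff, mem_ofPred_eq, mem_voidEvent,
      ← imp_iff_not_or]
    constructor
    · intro h i k hik
      exact subset_empty_iff.1 (h ▸ inter_subset_inter_right _ (Metric.ball_subset_ball' hik))
    · intro h
      refine eq_empty_of_forall_notMem ?_
      rintro z ⟨hz, hzc⟩
      rw [Metric.mem_ball] at hzc
      obtain ⟨k, hk⟩ := exists_nat_one_div_lt (show 0 < (r - dist z c) / 2 by linarith)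
      obtain ⟨i, hi⟩ := (TopologicalSpace.denseRange_denseSeq ℂ).exists_dist_lt z
        (ε := 1 / ((k : ℝ) + 1)) (by positivity)
      have := h i k (by
        have := dist_triangle_left (TopologicalSpace.denseSeq ℂ i) c z
        linarith)
      exact (this ▸ ⟨hz, hi⟩ : z ∈ (∅ : Set ℂ))
  rw [h]
  refine MeasurableSet.iInter fun i => MeasurableSet.iInter fun k => MeasurableSet.union ?_ ?_
  · exact (measurableSet_le (by fun_prop) (by fun_prop)).compl
  · exact (measurableSet_voidEvent measurableSet_ball measure_ball_lt_top).preimage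
      (measurable_snd.comp measurable_snd)

/-- A pair of points with increasing abscissas is equidistant from a point of abscissa in `[0, 1]`
of the axis, closer to which the configuration has no point, and from which the pair and the
mark are seen in `A`. -/
def handoverEvent (A : Set (ℂ × ℂ × ℝ)) : Set (ℂ × ℂ × Config × ℝ) :=
  {s | s.1.re < s.2.1.re ∧ axisCenter s.1 s.2.1 ∈ Icc (0 : ℝ) 1 ∧
    s.2.2.1 ∈ voidEvent (Metric.ball (axisCenter s.1 s.2.1 : ℂ)
      (dist (axisCenter s.1 s.2.1 : ℂ) s.1)) ∧
    (s.1 - axisCenter s.1 s.2.1, s.2.1 - axisCenter s.1 s.2.1, s.2.2.2) ∈ A}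

lemma measurable_axisCenter' :
    Measurable fun s : ℂ × ℂ × Config × ℝ => axisCenter s.1 s.2.1 :=
  measurable_axisCenter.comp (measurable_fst.prodMk (measurable_fst.comp measurable_snd))

lemma measurableSet_void_ball_comp {f : ℂ × ℂ × Config × ℝ → ℝ} (hf : Measurable f) :
    MeasurableSet {s : ℂ × ℂ × Config × ℝ |
      s.2.2.1 ∈ voidEvent (Metric.ball (axisCenter s.1 s.2.1 : ℂ) (f s))} := by
  have m1 : Measurable fun s : ℂ × ℂ × Config × ℝ => (axisCenter s.1 s.2.1 : ℂ) :=
    Complex.measurable_ofReal.comp measurable_axisCenter'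
  exact measurableSet_void_ball.preimage (m1.prodMk (hf.prodMk (by fun_prop)))

lemma measurable_dist_axisCenter :
    Measurable fun s : ℂ × ℂ × Config × ℝ => dist (axisCenter s.1 s.2.1 : ℂ) s.1 :=
  (Complex.measurable_ofReal.comp measurable_axisCenter').dist measurable_fst

lemma measurableSet_handoverEvent {A : Set (ℂ × ℂ × ℝ)} (hA : MeasurableSet A) :
    MeasurableSet (handoverEvent A) := by
  have m1 : Measurable fun s : ℂ × ℂ × Config × ℝ => (axisCenter s.1 s.2.1 : ℂ) :=
    Complex.measurable_ofReal.comp measurable_axisCenter'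
  have m2 : Measurable fun s : ℂ × ℂ × Config × ℝ =>
      (s.1 - (axisCenter s.1 s.2.1 : ℂ), s.2.1 - (axisCenter s.1 s.2.1 : ℂ), s.2.2.2) := by
    fun_prop
  exact (measurableSet_lt (f := fun s : ℂ × ℂ × Config × ℝ => s.1.re)
    (g := fun s => s.2.1.re) (by fun_prop) (by fun_prop)).inter
    ((measurable_axisCenter' measurableSet_Icc).inter
    ((measurableSet_void_ball_comp measurable_dist_axisCenter).inter (hA.preimage m2)))

/-- The two points of the pair have the same abscissa. -/
def verticalEvent : Set (ℂ × ℂ × Config × ℝ) := {s | s.1 ≠ s.2.1 ∧ s.1.re = s.2.1.re}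

lemma measurableSet_verticalEvent : MeasurableSet verticalEvent :=
  (measurableSet_eq_fun (by fun_prop) (by fun_prop)).compl.inter
    (measurableSet_eq_fun (by fun_prop) (by fun_prop))

/-- The rest of the configuration has points arbitrarily close to the circle centred on the axis
through the pair, but none inside it. -/
def cocircularEvent : Set (ℂ × ℂ × Config × ℝ) :=
  {s | s.1.re ≠ s.2.1.re ∧
    s.2.2.1 ∈ voidEvent (Metric.ball (axisCenter s.1 s.2.1 : ℂ)
      (dist (axisCenter s.1 s.2.1 : ℂ) s.1)) ∧
    ∀ n : ℕ, s.2.2.1 ∉ voidEvent (Metric.ball (axisCenter s.1 s.2.1 : ℂ)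
      (dist (axisCenter s.1 s.2.1 : ℂ) s.1 + 1 / ((n : ℝ) + 1)))}

lemma measurableSet_cocircularEvent : MeasurableSet cocircularEvent := by
  have h : MeasurableSet (⋂ n : ℕ, {s : ℂ × ℂ × Config × ℝ |
      s.2.2.1 ∈ voidEvent (Metric.ball (axisCenter s.1 s.2.1 : ℂ)
        (dist (axisCenter s.1 s.2.1 : ℂ) s.1 + 1 / ((n : ℝ) + 1)))}ᶜ) :=
    MeasurableSet.iInter fun n =>
      (measurableSet_void_ball_comp (measurable_dist_axisCenter.add_const _)).compl
  convert (measurableSet_eq_fun (f := fun s : ℂ × ℂ × Config × ℝ => s.1.re)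
    (g := fun s => s.2.1.re) (by fun_prop) (by fun_prop)).compl.inter
    ((measurableSet_void_ball_comp measurable_dist_axisCenter).inter h) using 1
  ext s
  simp [cocircularEvent]

lemma volume_re_eq (a : ℝ) : volume {y : ℂ | y.re = a} = 0 := by
  have h : {y : ℂ | y.re = a} = Complex.measurableEquivRealProd ⁻¹' ({a} ×ˢ univ) := by
    ext y; simp
  rw [h, Complex.volume_preserving_equiv_real_prod.measure_preimage
    ((measurableSet_singleton a).prod .univ).nullMeasurableSet]
  rw [Measure.volume_eq_prod, Measure.prod_prod]
  simp

/-- The abscissas in `[0, 1]` of the handovers whose base stations and mark are seen in `A`. -/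
def handoversIn (A : Set (ℂ × ℂ × ℝ)) (φ : Set ℂ) (c : ℝ) : Set ℝ :=
  {t ∈ Icc (0 : ℝ) 1 | ∃ x y, AreNeighborsAt φ (t : ℂ) x y ∧ (x - t, y - t, c) ∈ A}

/-- Both points lie on the boundary circle, hence not in the open ball. -/
lemma sdiff_pair_inter_ball (φ : Set ℂ) {x y : ℂ} (h : x.re ≠ y.re) :
    (φ \ {x, y}) ∩ Metric.ball (axisCenter x y : ℂ) (dist (axisCenter x y : ℂ) x) =
      φ ∩ Metric.ball (axisCenter x y : ℂ) (dist (axisCenter x y : ℂ) x) := by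
  ext z
  simp only [mem_inter_iff, mem_sdiff, mem_insert_iff, mem_singleton_iff, Metric.mem_ball']
  constructor
  · exact fun hz => ⟨hz.1.1, hz.2⟩
  · rintro ⟨hz, hd⟩
    refine ⟨⟨hz, ?_⟩, hd⟩
    rintro (rfl | rfl)
    · exact hd.ne rfl
    · exact hd.ne (dist_axisCenter h).symm

lemma inter_ball_eq_empty_iff {φ : Set ℂ} {c : ℂ} {r : ℝ} :
    φ ∩ Metric.ball c r = ∅ ↔ ∀ y ∈ φ, r ≤ dist c y := by
  simp only [eq_empty_iff_forall_notMem, mem_inter_iff, Metric.mem_ball', not_and, not_lt]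

/-- The map from a pair to its `axisCenter` is a bijection onto the handovers once vertical and
cocircular coincidences are excluded. The symmetry of `A` allows each pair to be ordered by
abscissa. -/
lemma encard_handoversIn {A : Set (ℂ × ℂ × ℝ)}
    (hA : ∀ u v c, (u, v, c) ∈ A → (v, u, c) ∈ A) {φ : Set ℂ} {c : ℝ}
    (h1 : pairSet φ c verticalEvent = ∅) (h2 : pairSet φ c cocircularEvent = ∅) :
    (handoversIn A φ c).encard = (pairSet φ c (handoverEvent A)).encard := by
  have hre : ∀ x ∈ φ, ∀ y ∈ φ, x ≠ y → x.re ≠ y.re := fun x hx y hy hne hre =>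
    (h1 ▸ (⟨hx, hy, hne, hne, hre⟩ : (x, y) ∈ pairSet φ c verticalEvent) : (x, y) ∈ (∅ : Set _))
  have huniq : ∀ x y, (x, y) ∈ pairSet φ c (handoverEvent A) → ∀ z ∈ φ,
      dist (axisCenter x y : ℂ) z = dist (axisCenter x y : ℂ) x → z = x ∨ z = y := by
    rintro x y ⟨hx, hy, hne, hlt, -, hv, -⟩ z hz hzd
    by_contra hzxy
    have : (x, y) ∈ pairSet φ c cocircularEvent := by
      refine ⟨hx, hy, hne, hlt.ne, hv, fun n => ?_⟩
      rw [mem_voidEvent, ← ne_eq, ← nonempty_iff_ne_empty]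
      refine ⟨z, ⟨hz, hzxy⟩, ?_⟩
      rw [Metric.mem_ball', hzd]
      simp only [lt_add_iff_pos_right]
      positivity
    rw [h2] at this
    exact this
  have hinj : InjOn (fun p : ℂ × ℂ => axisCenter p.1 p.2) (pairSet φ c (handoverEvent A)) := by
    rintro ⟨x, y⟩ hp ⟨x', y'⟩ hp' (heq : axisCenter x y = axisCenter x' y')
    have hp₀ := hp
    obtain ⟨hx, hy, hne, hlt, -, hv, -⟩ := hp
    obtain ⟨hx', hy', hne', hlt', -, hv', -⟩ := hp'
    simp only [mem_voidEvent] at hv hv' hlt hlt'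
    rw [sdiff_pair_inter_ball _ hlt.ne, inter_ball_eq_empty_iff] at hv
    rw [sdiff_pair_inter_ball _ hlt'.ne, inter_ball_eq_empty_iff, ← heq] at hv'
    -- Two pairs with the same centre lie on the same circle, because neither void ball contains a
    -- point of the other pair. That circle carries only two points, and the order of abscissas
    -- settles which comes first.
    have hr := le_antisymm (hv x' hx') (hv' x hx)
    have hr' : dist (axisCenter x y : ℂ) y' = dist (axisCenter x y : ℂ) x := by
      rw [hr, heq, dist_axisCenter hlt'.ne]
    have a := huniq x y hp₀ x' hx' hr.symm
    have b := huniq x y hp₀ y' hy' hr'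
    rcases a with rfl | rfl <;> rcases b with rfl | rfl
    · exact absurd hlt' (lt_irrefl _)
    · rfl
    · exact absurd hlt' hlt.not_gt
    · exact absurd hlt' (lt_irrefl _)
  rw [← hinj.encard_image]
  congr 1
  ext t
  constructor
  · rintro ⟨ht, x, y, ⟨hx, hy, hne, hcx, hcy⟩, hAt⟩
    have aux : ∀ x ∈ φ, ∀ y ∈ φ, x ≠ y → (t : ℂ) ∈ voronoiCell φ x → (t : ℂ) ∈ voronoiCell φ y →
        (x - t, y - t, c) ∈ A → x.re < y.re →
        t ∈ (fun p : ℂ × ℂ => axisCenter p.1 p.2) '' pairSet φ c (handoverEvent A) := by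
      intro x hx y hy hne hcx hcy hAt hlt
      have hteq : t = axisCenter x y :=
        (dist_eq_dist_iff hlt.ne t).1 (le_antisymm (hcx y hy) (hcy x hx))
      refine ⟨(x, y), ⟨hx, hy, hne, hlt, ?_, ?_, ?_⟩, hteq.symm⟩
      · rwa [← hteq]
      · rw [mem_voidEvent]
        simp only
        rw [sdiff_pair_inter_ball _ hlt.ne, inter_ball_eq_empty_iff, ← hteq]
        exact hcx
      · rwa [← hteq]
    rcases (hre x hx y hy hne).lt_or_gt with hlt | hlt
    · exact aux x hx y hy hne hcx hcy hAt hlt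
    · exact aux y hy x hx hne.symm hcy hcx (hA _ _ _ hAt) hlt
  · rintro ⟨⟨x, y⟩, ⟨hx, hy, hne, hlt, ht, hv, hAt⟩, rfl⟩
    simp only [mem_voidEvent] at hv hlt
    rw [sdiff_pair_inter_ball _ hlt.ne, inter_ball_eq_empty_iff] at hv
    refine ⟨ht, x, y, ⟨hx, hy, hne, hv, fun z hz => ?_⟩, hAt⟩
    rw [← dist_axisCenter hlt.ne]
    exact hv z hz

/-! ### Almost sure exclusion of degenerate pairs, and the mean as a double integral -/

namespace IsPoissonProcess

variable {Ω : Type*} [MeasurableSpace Ω] {P : Measure Ω} {lam : ℝ≥0}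
  {Φ : Ω → Set ℂ} {χ : Ω → ℝ}

lemma pairMeasure_apply [IsProbabilityMeasure P] {S : Set (ℂ × ℂ × Config × ℝ)}
    (hS : MeasurableSet S) :
    pairMeasure P lam Φ χ S = lam ^ 2 * ∫⁻ x : ℂ, ∫⁻ y : ℂ,
      ((P.map fun ω => (⟨Φ ω⟩ : Config)).prod (P.map χ)) {q | (x, y, q) ∈ S} := by
  have h : ∀ x : ℂ, MeasurableSet (Prod.mk x ⁻¹' S) := fun x => measurable_prodMk_left hS
  rw [pairMeasure, Measure.prod_apply hS]
  simp_rw [Measure.prod_apply (h _), lintegral_smul_measure, ENNReal.smul_def, smul_eq_mul]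
  rw [lintegral_const_mul' _ _ ENNReal.coe_ne_top, ← mul_assoc, sq]
  rfl

lemma ae_pairSet_verticalEvent_eq_empty [IsProbabilityMeasure P] (hΦ : IsPoissonProcess P lam Φ)
    (hχ : Measurable χ)
    (hindep : Indep (configSigma Φ) (MeasurableSpace.comap χ inferInstance) P) :
    ∀ᵐ ω ∂P, pairSet (Φ ω) (χ ω) verticalEvent = ∅ := by
  have h := hΦ.lintegral_pairSet hχ hindep measurableSet_verticalEvent fun s hs => hs.1
  have h0 : pairMeasure P lam Φ χ verticalEvent = 0 := by
    rw [pairMeasure_apply measurableSet_verticalEvent]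
    refine mul_eq_zero_of_right _ ?_
    rw [← lintegral_zero (μ := (volume : Measure ℂ))]
    refine lintegral_congr fun x => ?_
    rw [← lintegral_zero (μ := (volume : Measure ℂ))]
    refine lintegral_congr_ae ?_
    have : ∀ᵐ y : ℂ, y.re ≠ x.re :=
      measure_mono_null (fun y hy => by simpa using hy) (volume_re_eq x.re)
    filter_upwards [this] with y hy
    have : {q : Config × ℝ | (x, y, q) ∈ verticalEvent} = ∅ := by
      ext q
      simp only [verticalEvent, mem_ofPred_eq, mem_empty_iff_false, iff_false, not_and]
      exact fun _ h => hy h.symm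
    rw [this, measure_empty]
  rw [h0, lintegral_eq_zero_iff' h.1] at h
  filter_upwards [h.2] with ω hω
  simpa using hω

lemma ae_finite_inter_ball (hΦ : IsPoissonProcess P lam Φ) (c : ℂ) (r : ℝ) :
    ∀ᵐ ω ∂P, (Φ ω ∩ Metric.ball c r).Finite := by
  have h := hΦ.lintegral_pointCount (measurableSet_ball (x := c) (ε := r)) measure_ball_lt_top
  have m := hΦ.measurable_count _ (measurableSet_ball (x := c) (ε := r))
  have := ae_lt_top (f := fun ω => (pointCount (Φ ω) (Metric.ball c r) : ℝ≥0∞))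
    (Measurable.comp .of_discrete m) (h ▸ ENNReal.coe_ne_top)
  filter_upwards [this] with ω hω
  rw [← encard_lt_top_iff]
  simpa [pointCount] using hω

lemma ae_inter_sphere_eq_empty (hΦ : IsPoissonProcess P lam Φ) (c : ℂ) {r : ℝ} :
    ∀ᵐ ω ∂P, Φ ω ∩ Metric.sphere c r = ∅ := by
  have h0 : volume (Metric.sphere c r) = 0 := Measure.addHaar_sphere _ _ _
  have mS : MeasurableSet (Metric.sphere c r) := Metric.isClosed_sphere.measurableSet
  have h := hΦ.lintegral_pointCount mS (by simp [h0])
  rw [meanCount, h0, ENNReal.toNNReal_zero, mul_zero, ENNReal.coe_zero] at h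
  have h := (lintegral_eq_zero_iff (f := fun ω => (pointCount (Φ ω) (Metric.sphere c r) : ℝ≥0∞))
    (Measurable.comp .of_discrete (hΦ.measurable_count _ mS))).1 h
  filter_upwards [h] with ω hω
  simpa [pointCount] using hω

/-- For fixed `x` and `y`, the process almost surely has no point on the circle and finitely many
points in a larger ball. If the disc is void, a gap therefore separates the circle from the nearest
point, which contradicts the event. -/
lemma ae_pairSet_cocircularEvent_eq_empty [IsProbabilityMeasure P]
    (hΦ : IsPoissonProcess P lam Φ) (hχ : Measurable χ)
    (hindep : Indep (configSigma Φ) (MeasurableSpace.comap χ inferInstance) P) :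
    ∀ᵐ ω ∂P, pairSet (Φ ω) (χ ω) cocircularEvent = ∅ := by
  have h := hΦ.lintegral_pairSet hχ hindep measurableSet_cocircularEvent
    fun s hs he => hs.1 (by rw [he])
  have h0 : pairMeasure P lam Φ χ cocircularEvent = 0 := by
    rw [pairMeasure_apply measurableSet_cocircularEvent]
    refine mul_eq_zero_of_right _ ?_
    rw [← lintegral_zero (μ := (volume : Measure ℂ))]
    refine lintegral_congr fun x => ?_
    rw [← lintegral_zero (μ := (volume : Measure ℂ))]
    refine lintegral_congr fun y => ?_
    have mS : MeasurableSet {q : Config × ℝ | (x, y, q) ∈ cocircularEvent} :=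
      measurable_prodMk_left (measurable_prodMk_left measurableSet_cocircularEvent)
    rw [Measure.measure_prod_null mS]
    have mS' : MeasurableSet {φ : Config | (x, y, φ, (0 : ℝ)) ∈ cocircularEvent} :=
      measurable_prodMk_right mS
    -- The event ignores the mark, so the mark may be set to 0.
    have hcongr : ∀ φ : Config, ∀ c : ℝ, (x, y, φ, c) ∈ cocircularEvent ↔
      (x, y, φ, (0 : ℝ)) ∈ cocircularEvent := fun φ c => Iff.rfl
    suffices hs : ∀ᵐ φ ∂(P.map fun ω => (⟨Φ ω⟩ : Config)),
        (x, y, φ, (0 : ℝ)) ∉ cocircularEvent by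
      filter_upwards [hs] with φ hφ
      have : Prod.mk φ ⁻¹' {q : Config × ℝ | (x, y, q) ∈ cocircularEvent} = ∅ := by
        ext c; exact iff_of_false (fun hc => hφ ((hcongr φ c).1 hc)) id
      rw [this, measure_empty]; rfl
    refine (ae_map_iff (p := fun φ => (x, y, φ, (0 : ℝ)) ∉ cocircularEvent)
      hΦ.measurable_config.aemeasurable mS'.compl).2 ?_
    filter_upwards [hΦ.ae_finite_inter_ball (axisCenter x y) (dist (axisCenter x y : ℂ) x + 1),
      hΦ.ae_inter_sphere_eq_empty (axisCenter x y) (r := dist (axisCenter x y : ℂ) x)]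
      with ω hfin hsph
    rintro ⟨-, hv, hn⟩
    simp only [mem_voidEvent] at hv hn
    rw [inter_ball_eq_empty_iff] at hv
    have hev : ∀ᶠ n : ℕ in Filter.atTop, ∀ z ∈ Φ ω ∩ Metric.ball (axisCenter x y : ℂ)
        (dist (axisCenter x y : ℂ) x + 1),
        1 / ((n : ℝ) + 1) < dist (axisCenter x y : ℂ) z - dist (axisCenter x y : ℂ) x := by
      rw [Filter.eventually_all_finite hfin]
      rintro z ⟨hz, -⟩
      refine (tendsto_one_div_add_atTop_nhds_zero_nat (𝕜 := ℝ)).eventually_lt_const ?_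
      rw [sub_pos]
      refine lt_of_le_of_ne (hv z hz) fun he => ?_
      exact (hsph ▸ ⟨hz, by rw [Metric.mem_sphere', he]⟩ : z ∈ (∅ : Set ℂ))
    obtain ⟨n, hn'⟩ := hev.exists
    refine hn n (inter_ball_eq_empty_iff.2 fun z hz => ?_)
    by_contra! hlt
    have h1 : 1 / ((n : ℝ) + 1) ≤ 1 := by
      rw [div_le_one (by positivity)]; linarith [Nat.cast_nonneg (α := ℝ) n]
    have := hn' z ⟨hz, by rw [Metric.mem_ball']; linarith⟩
    linarith
  rw [h0, lintegral_eq_zero_iff' h.1] at h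
  filter_upwards [h.2] with ω hω
  simpa using hω

lemma map_config_void_ball (hΦ : IsPoissonProcess P lam Φ) (c : ℂ) {r : ℝ} (hr : 0 ≤ r) :
    P.map (fun ω => (⟨Φ ω⟩ : Config)) (voidEvent (Metric.ball c r)) =
      ENNReal.ofReal (Real.exp (-(lam * Real.pi * r ^ 2))) := by
  rw [hΦ.map_config_voidEvent measurableSet_ball measure_ball_lt_top, meanCount,
    Complex.volume_ball]
  have h : ((ENNReal.ofReal r).toNNReal : ℝ) = r := ENNReal.toReal_ofReal hr
  congr 3
  simp [h]
  ring

open Classical in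
/-- The mean number of handovers in `[0, 1]` whose base stations and mark are seen in `A`, as an
integral over the positions of the two base stations. -/
theorem lintegral_handoversIn [IsProbabilityMeasure P] (hΦ : IsPoissonProcess P lam Φ)
    (hχ : Measurable χ)
    (hindep : Indep (configSigma Φ) (MeasurableSpace.comap χ inferInstance) P)
    {A : Set (ℂ × ℂ × ℝ)} (hAm : MeasurableSet A) (hA : ∀ u v c, (u, v, c) ∈ A → (v, u, c) ∈ A) :
    ∫⁻ ω, ((handoversIn A (Φ ω) (χ ω)).encard : ℝ≥0∞) ∂P =
      lam ^ 2 * ∫⁻ x : ℂ, ∫⁻ y : ℂ, if x.re < y.re ∧ axisCenter x y ∈ Icc (0 : ℝ) 1 then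
        ENNReal.ofReal (Real.exp (-(lam * Real.pi * dist (axisCenter x y : ℂ) x ^ 2))) *
          P.map χ {c | (x - axisCenter x y, y - axisCenter x y, c) ∈ A} else 0 := by
  have he : (fun ω => ((handoversIn A (Φ ω) (χ ω)).encard : ℝ≥0∞)) =ᵐ[P]
      fun ω => ((pairSet (Φ ω) (χ ω) (handoverEvent A)).encard : ℝ≥0∞) := by
    filter_upwards [hΦ.ae_pairSet_verticalEvent_eq_empty hχ hindep,
      hΦ.ae_pairSet_cocircularEvent_eq_empty hχ hindep] with ω h1 h2
    rw [encard_handoversIn hA h1 h2]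
  rw [lintegral_congr_ae he, (hΦ.lintegral_pairSet hχ hindep (measurableSet_handoverEvent hAm)
    fun s hs he => hs.1.ne (by rw [he])).2, pairMeasure_apply (measurableSet_handoverEvent hAm)]
  congr 1
  refine lintegral_congr fun x => lintegral_congr fun y => ?_
  split_ifs with h
  · have : {q : Config × ℝ | (x, y, q) ∈ handoverEvent A} =
        voidEvent (Metric.ball (axisCenter x y : ℂ) (dist (axisCenter x y : ℂ) x)) ×ˢ
          {c | (x - axisCenter x y, y - axisCenter x y, c) ∈ A} := by
      ext ⟨φ, c⟩
      exact ⟨fun hq => ⟨hq.2.2.1, hq.2.2.2⟩, fun hq => ⟨h.1, h.2, hq.1, hq.2⟩⟩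
    rw [this, Measure.prod_prod, hΦ.map_config_void_ball _ dist_nonneg]
  · have : {q : Config × ℝ | (x, y, q) ∈ handoverEvent A} = ∅ := by
      ext q
      exact iff_of_false (fun hq => h ⟨hq.1, hq.2.1⟩) id
    rw [this, measure_empty]

end IsPoissonProcess

/-! ### Change of variables from the second point to centre and direction -/

/-- The distance from `(t, 0)` to `(a, h)`. -/
noncomputable def axisDist (a h t : ℝ) : ℝ := Real.sqrt ((t - a) ^ 2 + h ^ 2)

lemma axisDist_pos {h : ℝ} (hh : h ≠ 0) (a t : ℝ) : 0 < axisDist a h t :=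
  Real.sqrt_pos.2 (by positivity)

lemma axisDist_sq (a h t : ℝ) : axisDist a h t ^ 2 = (t - a) ^ 2 + h ^ 2 :=
  Real.sq_sqrt (by positivity)

lemma norm_sub_ofReal (x : ℂ) (t : ℝ) : ‖x - t‖ = axisDist x.re x.im t := by
  rw [← dist_eq_norm, dist_comm, axisDist, ← dist_ofReal_sq, Real.sqrt_sq dist_nonneg]

lemma hasDerivAt_axisDist {h : ℝ} (hh : h ≠ 0) (a t : ℝ) :
    HasDerivAt (axisDist a h) ((t - a) / axisDist a h t) t := by
  have h1 : HasDerivAt (fun t : ℝ => (t - a) ^ 2 + h ^ 2) (2 * (t - a)) t := by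
    have := (((hasDerivAt_id t).sub_const a).pow 2).add_const (h ^ 2)
    simpa using this
  refine (h1.sqrt (by positivity)).congr_deriv ?_
  simp only [axisDist]
  field_simp

/-- The point seen from `(t, 0)` in the direction `β` and at the same distance as `(a, h)`, where
`p = (t, β)`. -/
noncomputable def coCircle (a h : ℝ) (p : ℝ × ℝ) : ℝ × ℝ :=
  (p.1 + axisDist a h p.1 * Real.cos p.2, axisDist a h p.1 * Real.sin p.2)

/-- The derivative of `coCircle`. -/
noncomputable def fderivCoCircle (a h : ℝ) (p : ℝ × ℝ) : ℝ × ℝ →L[ℝ] ℝ × ℝ :=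
  (Matrix.toLin (.finTwoProd ℝ) (.finTwoProd ℝ)
    !![1 + (p.1 - a) / axisDist a h p.1 * Real.cos p.2, -axisDist a h p.1 * Real.sin p.2;
      (p.1 - a) / axisDist a h p.1 * Real.sin p.2,
        axisDist a h p.1 * Real.cos p.2]).toContinuousLinearMap

lemma hasFDerivAt_coCircle {h : ℝ} (hh : h ≠ 0) (a : ℝ) (p : ℝ × ℝ) :
    HasFDerivAt (coCircle a h) (fderivCoCircle a h p) p := by
  unfold fderivCoCircle
  rw [Matrix.toLin_finTwoProd_toContinuousLinearMap]
  have hr := (hasDerivAt_axisDist hh a p.1).comp_hasFDerivAt p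
    (hasFDerivAt_fst (𝕜 := ℝ) (E := ℝ) (F := ℝ) (p := p))
  have hc := (Real.hasDerivAt_cos p.2).comp_hasFDerivAt p
    (hasFDerivAt_snd (𝕜 := ℝ) (E := ℝ) (F := ℝ) (p := p))
  have hs := (Real.hasDerivAt_sin p.2).comp_hasFDerivAt p
    (hasFDerivAt_snd (𝕜 := ℝ) (E := ℝ) (F := ℝ) (p := p))
  have := (hasFDerivAt_fst.add (hr.mul hc)).prodMk (hr.mul hs)
  refine this.congr_fderiv ?_
  ext <;> simp <;> ring

/-- The Jacobian is the abscissa of `coCircle a h p` minus `a`, so it is positive exactly when the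
image lies to the right of `(a, h)`. -/
lemma det_fderivCoCircle {h : ℝ} (hh : h ≠ 0) (a : ℝ) (p : ℝ × ℝ) :
    (fderivCoCircle a h p).det = axisDist a h p.1 * Real.cos p.2 + p.1 - a := by
  have hr := (axisDist_pos hh a p.1).ne'
  unfold fderivCoCircle
  simp only [LinearMap.det_toContinuousLinearMap, LinearMap.det_toLin, Matrix.det_fin_two_of]
  have := Real.sin_sq_add_cos_sq p.2
  field_simp
  linear_combination (p.1 - a) * this

/-- The domain on which `coCircle` parametrizes the half-plane on the right of `(a, h)`. -/
def coCircleDomain (a h : ℝ) : Set (ℝ × ℝ) :=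
  {p | p.2 ∈ Ioc (-Real.pi) Real.pi ∧ 0 < axisDist a h p.1 * Real.cos p.2 + p.1 - a}

@[fun_prop]
lemma measurable_axisDist (a h : ℝ) : Measurable (axisDist a h) := by
  unfold axisDist; fun_prop

lemma measurableSet_coCircleDomain (a h : ℝ) : MeasurableSet (coCircleDomain a h) :=
  (measurableSet_Ioc.preimage measurable_snd).inter
    (measurableSet_lt (f := fun _ => (0 : ℝ))
      (g := fun p : ℝ × ℝ => axisDist a h p.1 * Real.cos p.2 + p.1 - a)
      (by fun_prop) (by fun_prop))

lemma axisCenter_coCircle {a h : ℝ} {p : ℝ × ℝ} (hp : p ∈ coCircleDomain a h) :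
    axisCenter ⟨a, h⟩ ⟨(coCircle a h p).1, (coCircle a h p).2⟩ = p.1 := by
  have h2 := hp.2
  have h3 := axisDist_sq a h p.1
  have h4 := Real.sin_sq_add_cos_sq p.2
  simp only [axisCenter, coCircle]
  rw [div_eq_iff (by linarith)]
  linear_combination axisDist a h p.1 ^ 2 * h4 + h3

/-- The centre is recovered as `axisCenter`, and the direction as a principal argument. -/
lemma injOn_coCircle {h : ℝ} (hh : h ≠ 0) (a : ℝ) : InjOn (coCircle a h) (coCircleDomain a h) := by
  intro p hp q hq heq
  have h1 : p.1 = q.1 := by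
    rw [← axisCenter_coCircle hp, ← axisCenter_coCircle hq, heq]
  have hr := axisDist_pos hh a q.1
  simp only [coCircle, h1, Prod.mk.injEq, add_right_inj] at heq
  have hcos := mul_left_cancel₀ hr.ne' heq.1
  have hsin := mul_left_cancel₀ hr.ne' heq.2
  refine Prod.ext h1 ?_
  have e1 := Complex.arg_cos_add_sin_mul_I hp.1
  have e2 := Complex.arg_cos_add_sin_mul_I hq.1
  rw [← e1, ← e2, ← Complex.ofReal_cos, ← Complex.ofReal_sin, hcos, hsin, Complex.ofReal_cos,
    Complex.ofReal_sin]

lemma image_coCircle {h : ℝ} (a : ℝ) :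
    coCircle a h '' coCircleDomain a h = {q | a < q.1} := by
  ext ⟨b, k⟩
  constructor
  · rintro ⟨p, hp, heq⟩
    have h2 := hp.2
    simp only [coCircle, Prod.mk.injEq] at heq
    simp only [mem_ofPred_eq]
    linarith [heq.1]
  · intro (hb : a < b)
    set t := axisCenter ⟨a, h⟩ ⟨b, k⟩ with ht
    have hd : dist (t : ℂ) ⟨a, h⟩ = dist (t : ℂ) ⟨b, k⟩ := dist_axisCenter hb.ne
    have hr : axisDist a h t = ‖(⟨b, k⟩ : ℂ) - t‖ := by
      rw [← dist_eq_norm, dist_comm, ← hd, dist_comm, dist_eq_norm, norm_sub_ofReal]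
    have hc := Complex.norm_mul_cos_arg ((⟨b, k⟩ : ℂ) - t)
    have hs := Complex.norm_mul_sin_arg ((⟨b, k⟩ : ℂ) - t)
    simp only [Complex.sub_re, Complex.ofReal_re, Complex.sub_im, Complex.ofReal_im] at hc hs
    refine ⟨(t, Complex.arg ((⟨b, k⟩ : ℂ) - t)), ⟨⟨Complex.neg_pi_lt_arg _, Complex.arg_le_pi _⟩, ?_⟩, ?_⟩
    · dsimp only
      rw [hr, hc]
      linarith
    · simp only [coCircle]
      rw [hr, hc, hs]
      simp

lemma lintegral_right_halfPlane {x : ℂ} (hx : x.im ≠ 0) (H : ℝ → ℂ → ℝ≥0∞) :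
    ∫⁻ y in {y : ℂ | x.re < y.re}, H (axisCenter x y) (y - axisCenter x y) =
      ∫⁻ p in coCircleDomain x.re x.im,
        ENNReal.ofReal (‖x - (p.1 : ℂ)‖ * Real.cos p.2 + p.1 - x.re) *
          H p.1 (‖x - (p.1 : ℂ)‖ * Complex.exp (p.2 * Complex.I)) := by
  have m1 : MeasurableSet {q : ℝ × ℝ | x.re < q.1} := measurableSet_lt (by fun_prop) (by fun_prop)
  have e1 : ∫⁻ y in {y : ℂ | x.re < y.re}, H (axisCenter x y) (y - axisCenter x y) =
      ∫⁻ q in {q : ℝ × ℝ | x.re < q.1}, H (axisCenter x ⟨q.1, q.2⟩)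
        ((⟨q.1, q.2⟩ : ℂ) - axisCenter x ⟨q.1, q.2⟩) := by
    have := Complex.volume_preserving_equiv_real_prod.symm.setLIntegral_comp_preimage_emb
      Complex.measurableEquivRealProd.symm.measurableEmbedding
      (fun y => H (axisCenter x y) (y - axisCenter x y)) {y : ℂ | x.re < y.re}
    rw [← this]
    rfl
  rw [e1, ← image_coCircle (h := x.im), lintegral_image_eq_lintegral_abs_det_fderiv_mul volume
    (measurableSet_coCircleDomain _ _)
    (fun p _ => (hasFDerivAt_coCircle hx x.re p).hasFDerivWithinAt) (injOn_coCircle hx x.re)]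
  refine setLIntegral_congr_fun (measurableSet_coCircleDomain _ _) fun p hp => ?_
  have hp2 := hp.2
  have hc : axisCenter x ⟨(coCircle x.re x.im p).1, (coCircle x.re x.im p).2⟩ = p.1 :=
    axisCenter_coCircle hp
  rw [det_fderivCoCircle hx, abs_of_pos hp2, norm_sub_ofReal, hc]
  congr 2
  rw [Complex.exp_mul_I]
  apply Complex.ext <;>
    simp [coCircle, ← Complex.ofReal_cos, ← Complex.ofReal_sin]

lemma volume_im_eq (a : ℝ) : volume {y : ℂ | y.im = a} = 0 := by
  have h : {y : ℂ | y.im = a} = Complex.measurableEquivRealProd ⁻¹' (univ ×ˢ {a}) := by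
    ext y; simp
  rw [h, Complex.volume_preserving_equiv_real_prod.measure_preimage
    (MeasurableSet.univ.prod (measurableSet_singleton a)).nullMeasurableSet]
  rw [Measure.volume_eq_prod, Measure.prod_prod]
  simp

/-- The weight of a base station at `u`, seen from a handover together with another base station
on its right. -/
noncomputable def stationWeight (G : ℂ → ℂ → ℝ≥0∞) (u : ℂ) : ℝ≥0∞ :=
  ∫⁻ β in Ioc (-Real.pi) Real.pi, ENNReal.ofReal (‖u‖ * Real.cos β - u.re) *
    G u (‖u‖ * Complex.exp (β * Complex.I))

lemma measurable_stationWeight {G : ℂ → ℂ → ℝ≥0∞} (hG : Measurable (Function.uncurry G)) :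
    Measurable (stationWeight G) := by
  have h : Measurable (Function.uncurry fun (u : ℂ) (β : ℝ) =>
      ENNReal.ofReal (‖u‖ * Real.cos β - u.re) * G u (‖u‖ * Complex.exp (β * Complex.I))) := by
    refine Measurable.mul (by fun_prop) ?_
    exact hG.comp (f := fun p : ℂ × ℝ => (p.1, (‖p.1‖ : ℂ) * Complex.exp (p.2 * Complex.I)))
      (by fun_prop)
  exact h.lintegral_prod_right'

-- After the change of variables in `y`, the integrand depends on `x` only through `x - t`.
-- Translation invariance then removes `t`, which ranges over an interval of length 1.
open Classical in
lemma lintegral_pairs {G : ℂ → ℂ → ℝ≥0∞} (hG : Measurable (Function.uncurry G)) :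
    ∫⁻ x : ℂ, ∫⁻ y : ℂ, (if x.re < y.re ∧ axisCenter x y ∈ Icc (0 : ℝ) 1 then
      G (x - axisCenter x y) (y - axisCenter x y) else 0) = ∫⁻ u, stationWeight G u := by
  have hx0 : ∀ᵐ x : ℂ, x.im ≠ 0 :=
    measure_mono_null (fun y hy => by simpa using hy) (volume_im_eq 0)
  have inner : ∀ᵐ x : ℂ, ∫⁻ y : ℂ, (if x.re < y.re ∧ axisCenter x y ∈ Icc (0 : ℝ) 1 then
      G (x - axisCenter x y) (y - axisCenter x y) else 0) =
      ∫⁻ t in Icc (0 : ℝ) 1, stationWeight G (x - t) := by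
    filter_upwards [hx0] with x hx
    let H : ℝ → ℂ → ℝ≥0∞ := fun t v => (Icc (0 : ℝ) 1).indicator (fun t => G (x - t) v) t
    have mre : MeasurableSet {y : ℂ | x.re < y.re} := measurableSet_lt (by fun_prop) (by fun_prop)
    have e1 : ∫⁻ y : ℂ, (if x.re < y.re ∧ axisCenter x y ∈ Icc (0 : ℝ) 1 then
        G (x - axisCenter x y) (y - axisCenter x y) else 0) =
        ∫⁻ y in {y : ℂ | x.re < y.re}, H (axisCenter x y) (y - axisCenter x y) := by
      rw [← lintegral_indicator mre]
      refine lintegral_congr fun y => ?_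
      simp only [H, indicator_apply, mem_ofPred_eq, ite_and]
    have e2 : ∫⁻ (p : ℝ × ℝ) in coCircleDomain x.re x.im,
        ENNReal.ofReal (‖x - (p.1 : ℂ)‖ * Real.cos p.2 + p.1 - x.re) *
          H p.1 (‖x - (p.1 : ℂ)‖ * Complex.exp (p.2 * Complex.I)) =
        ∫⁻ (p : ℝ × ℝ) in univ ×ˢ Ioc (-Real.pi) Real.pi,
        ENNReal.ofReal (‖x - (p.1 : ℂ)‖ * Real.cos p.2 + p.1 - x.re) *
          H p.1 (‖x - (p.1 : ℂ)‖ * Complex.exp (p.2 * Complex.I)) := by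
      rw [← lintegral_indicator (measurableSet_coCircleDomain _ _),
        ← lintegral_indicator (MeasurableSet.univ.prod measurableSet_Ioc)]
      refine lintegral_congr fun p => ?_
      by_cases hp : p ∈ coCircleDomain x.re x.im
      · rw [indicator_of_mem hp, indicator_of_mem
          (show p ∈ (univ ×ˢ Ioc (-Real.pi) Real.pi : Set (ℝ × ℝ)) from ⟨trivial, hp.1⟩)]
      · rw [indicator_of_notMem hp]
        by_cases hp' : p ∈ (univ ×ˢ Ioc (-Real.pi) Real.pi : Set (ℝ × ℝ))
        -- In the strip but outside the domain the Jacobian is nonpositive and `ENNReal.ofReal`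
        -- sends it to 0, so the domain may be enlarged to the full strip.
        · rw [indicator_of_mem hp', ENNReal.ofReal_of_nonpos, zero_mul]
          rw [norm_sub_ofReal]
          by_contra! hlt
          exact hp ⟨hp'.2, hlt⟩
        · rw [indicator_of_notMem hp']
    have mH : Measurable fun p : ℝ × ℝ =>
        ENNReal.ofReal (‖x - (p.1 : ℂ)‖ * Real.cos p.2 + p.1 - x.re) *
          H p.1 (‖x - (p.1 : ℂ)‖ * Complex.exp (p.2 * Complex.I)) := by
      refine Measurable.mul (by fun_prop) ?_
      have : Measurable fun p : ℝ × ℝ =>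
          G (x - p.1) (‖x - (p.1 : ℂ)‖ * Complex.exp (p.2 * Complex.I)) :=
        hG.comp (f := fun p : ℝ × ℝ =>
          (x - (p.1 : ℂ), (‖x - (p.1 : ℂ)‖ : ℂ) * Complex.exp (p.2 * Complex.I))) (by fun_prop)
      exact this.indicator (measurableSet_Icc.preimage measurable_fst)
    rw [e1, lintegral_right_halfPlane hx H, e2, Measure.volume_eq_prod,
      setLIntegral_prod _ mH.aemeasurable, Measure.restrict_univ, ← lintegral_indicator measurableSet_Icc]
    refine lintegral_congr fun t => ?_
    by_cases ht : t ∈ Icc (0 : ℝ) 1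
    · rw [indicator_of_mem ht, stationWeight]
      refine lintegral_congr fun β => ?_
      simp only [H, indicator_of_mem ht, Complex.sub_re, Complex.ofReal_re]
      congr 2
      ring
    · simp [H, indicator_of_notMem ht]
  rw [lintegral_congr_ae inner, lintegral_lintegral_swap]
  · simp_rw [lintegral_sub_right_eq_self (stationWeight G)]
    simp
  · exact ((measurable_stationWeight hG).comp
      (f := fun p : ℂ × ℝ => p.1 - (p.2 : ℂ)) (by fun_prop)).aemeasurable

/-- Scale invariance of `q` separates radius from directions. One factor `r` of `r ^ 2` comes from
polar coordinates, the other from `‖u‖ cos β - u.re = r (cos β - cos α)`. -/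
lemma lintegral_stationWeight {q : ℂ → ℂ → ℝ≥0∞} (hq : Measurable (Function.uncurry q))
    (hscale : ∀ (r : ℝ) u v, 0 < r → q (r * u) (r * v) = q u v) (L : ℝ) :
    ∫⁻ u, stationWeight (fun u v => ENNReal.ofReal (Real.exp (-(L * ‖u‖ ^ 2))) * q u v) u =
      (∫⁻ r in Ioi (0 : ℝ), ENNReal.ofReal (r ^ 2 * Real.exp (-(L * r ^ 2)))) *
      ∫⁻ α in Ioc (-Real.pi) Real.pi, ∫⁻ β in Ioc (-Real.pi) Real.pi,
        ENNReal.ofReal (Real.cos β - Real.cos α) *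
          q (Complex.exp (α * Complex.I)) (Complex.exp (β * Complex.I)) := by
  set T : ℝ → ℝ≥0∞ := fun α => ∫⁻ β in Ioc (-Real.pi) Real.pi,
        ENNReal.ofReal (Real.cos β - Real.cos α) *
          q (Complex.exp (α * Complex.I)) (Complex.exp (β * Complex.I)) with hT
  have mT : Measurable T := by
    have h : Measurable (Function.uncurry fun (α β : ℝ) =>
        ENNReal.ofReal (Real.cos β - Real.cos α) *
          q (Complex.exp (α * Complex.I)) (Complex.exp (β * Complex.I))) := by
      refine Measurable.mul (by fun_prop) ?_
      exact hq.comp (f := fun p : ℝ × ℝ => (Complex.exp (p.1 * Complex.I),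
        Complex.exp (p.2 * Complex.I))) (by fun_prop)
    exact h.lintegral_prod_right'
  have key : ∀ p ∈ polarCoord.target, ENNReal.ofReal p.1 •
      stationWeight (fun u v => ENNReal.ofReal (Real.exp (-(L * ‖u‖ ^ 2))) * q u v)
        (Complex.polarCoord.symm p) =
      ENNReal.ofReal (p.1 ^ 2 * Real.exp (-(L * p.1 ^ 2))) * T p.2 := by
    rintro ⟨r, α⟩ ⟨hr, -⟩
    have hr : 0 < r := hr
    have hu : Complex.polarCoord.symm (r, α) = r * Complex.exp (α * Complex.I) := by
      rw [Complex.polarCoord_symm_apply, Complex.exp_mul_I, Complex.ofReal_cos, Complex.ofReal_sin]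
    have hn : ‖(r : ℂ) * Complex.exp (α * Complex.I)‖ = r := by
      rw [norm_mul, Complex.norm_exp_ofReal_mul_I, Complex.norm_of_nonneg hr.le, mul_one]
    have hre : ((r : ℂ) * Complex.exp (α * Complex.I)).re = r * Real.cos α := by
      rw [Complex.re_ofReal_mul, Complex.exp_ofReal_mul_I_re]
    rw [hu, stationWeight, hn, hre, smul_eq_mul, hT]
    dsimp only
    rw [← lintegral_const_mul' _ _ ENNReal.ofReal_ne_top, ← lintegral_const_mul' _ _ ENNReal.ofReal_ne_top]
    refine lintegral_congr fun β => ?_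
    rw [hscale _ _ _ hr, ← mul_sub, ENNReal.ofReal_mul hr.le,
      ENNReal.ofReal_mul (by positivity), sq, ENNReal.ofReal_mul hr.le]
    ring
  rw [← Complex.lintegral_comp_polarCoord_symm,
    setLIntegral_congr_fun polarCoord.open_target.measurableSet key, polarCoord_target,
    Measure.volume_eq_prod, setLIntegral_prod _ (by
      refine Measurable.aemeasurable (Measurable.mul (by fun_prop) (mT.comp measurable_snd)))]
  dsimp only
  rw [restrict_Ioo_eq_restrict_Ioc]
  simp_rw [lintegral_const_mul _ mT]
  rw [lintegral_mul_const _ (by fun_prop)]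

/-! ### Panels as a partition of the directions -/

/-- The angles of the directions covered by panel number `k`, as an interval of length
`2π / 2^m`. -/
def panelInterval (m : ℕ) (c : ℝ) (k : Fin (2 ^ m)) : Set ℝ :=
  Ico (c + 2 * (k : ℝ) * Real.pi / 2 ^ m) (c + 2 * ((k : ℝ) + 1) * Real.pi / 2 ^ m)

/-- All the angles of the directions covered by panel number `k`. -/
def panelAngles (m : ℕ) (c : ℝ) (k : Fin (2 ^ m)) : Set ℝ :=
  {a | ∃ n : ℤ, a + n * (2 * Real.pi) ∈ panelInterval m c k}

lemma mem_beam_iff {m : ℕ} {c : ℝ} {k : Fin (2 ^ m)} {r : ℝ} (hr : 0 < r) (a : ℝ) :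
    (r : ℂ) * Complex.exp (a * Complex.I) ∈ beam m c k ↔ a ∈ panelAngles m c k := by
  constructor
  · rintro ⟨r', a', hr', ha', heq⟩
    have hn := congrArg norm heq
    rw [norm_mul, norm_mul, Complex.norm_exp_ofReal_mul_I, Complex.norm_exp_ofReal_mul_I,
      Complex.norm_of_nonneg hr.le, Complex.norm_of_nonneg hr'.le, mul_one, mul_one] at hn
    subst hn
    have hexp := mul_left_cancel₀ (Complex.ofReal_ne_zero.2 hr.ne') heq
    obtain ⟨n, hn⟩ := Complex.exp_eq_exp_iff_exists_int.1 hexp.symm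
    refine ⟨n, ?_⟩
    have : a' = a + n * (2 * Real.pi) := by
      have h2 : (a' : ℂ) * Complex.I = ((a + n * (2 * Real.pi) : ℝ) : ℂ) * Complex.I := by
        rw [hn]; push_cast; ring
      exact_mod_cast mul_right_cancel₀ Complex.I_ne_zero h2
    rwa [← this]
  · rintro ⟨n, hn⟩
    refine ⟨r, _, hr, hn, ?_⟩
    congr 1
    refine Complex.exp_eq_exp_iff_exists_int.2 ⟨-n, ?_⟩
    push_cast; ring

lemma mem_beam_iff_arg {m : ℕ} {c : ℝ} {k : Fin (2 ^ m)} (w : ℂ) :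
    w ∈ beam m c k ↔ w ≠ 0 ∧ Complex.arg w ∈ panelAngles m c k := by
  by_cases hw : w = 0
  · subst hw
    simp only [ne_eq, not_true_eq_false, false_and, iff_false]
    rintro ⟨r, a, hr, -, h⟩
    exact mul_ne_zero (Complex.ofReal_ne_zero.2 hr.ne') (Complex.exp_ne_zero _) h.symm
  · rw [← mem_beam_iff (norm_pos_iff.2 hw), Complex.norm_mul_exp_arg_mul_I]
    simp [hw]

lemma panelAngles_add_two_pi {m : ℕ} {c : ℝ} {k : Fin (2 ^ m)} (a : ℝ) :
    a + 2 * Real.pi ∈ panelAngles m c k ↔ a ∈ panelAngles m c k := by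
  constructor
  · rintro ⟨n, hn⟩
    refine ⟨n + 1, ?_⟩
    convert hn using 1
    push_cast; ring
  · rintro ⟨n, hn⟩
    refine ⟨n - 1, ?_⟩
    convert hn using 1
    push_cast; ring

lemma measurableSet_beam (m : ℕ) (k : Fin (2 ^ m)) :
    MeasurableSet {p : ℂ × ℝ | p.1 ∈ beam m p.2 k} := by
  have h : {p : ℂ × ℝ | p.1 ∈ beam m p.2 k} = {p | p.1 ≠ 0} ∩ ⋃ n : ℤ,
      ({p | p.2 + 2 * (k : ℝ) * Real.pi / 2 ^ m ≤ Complex.arg p.1 + n * (2 * Real.pi)} ∩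
      {p | Complex.arg p.1 + n * (2 * Real.pi) < p.2 + 2 * ((k : ℝ) + 1) * Real.pi / 2 ^ m}) := by
    ext p
    rw [mem_ofPred_eq, mem_beam_iff_arg]
    simp [panelAngles, panelInterval]
  rw [h]
  refine (measurableSet_eq_fun measurable_fst measurable_const).compl.inter
    (MeasurableSet.iUnion fun n => MeasurableSet.inter ?_ ?_)
  · exact measurableSet_le (by fun_prop) (by fun_prop)
  · exact measurableSet_lt (by fun_prop) (by fun_prop)

/-- Two base stations, given by their positions relative to the user, are in the beams of two
different panels. -/
def swapSet (m : ℕ) : Set (ℂ × ℂ × ℝ) :=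
  {s | ∃ k l, k ≠ l ∧ s.1 ∈ beam m s.2.2 k ∧ s.2.1 ∈ beam m s.2.2 l}

lemma measurableSet_swapSet (m : ℕ) : MeasurableSet (swapSet m) := by
  have h : swapSet m = ⋃ (k : Fin (2 ^ m)) (l : Fin (2 ^ m)) (_ : k ≠ l),
      ({s : ℂ × ℂ × ℝ | (s.1, s.2.2) ∈ {p : ℂ × ℝ | p.1 ∈ beam m p.2 k}} ∩
        {s : ℂ × ℂ × ℝ | (s.2.1, s.2.2) ∈ {p : ℂ × ℝ | p.1 ∈ beam m p.2 l}}) := by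
    ext s
    simp only [swapSet, mem_iUnion, mem_inter_iff, mem_ofPred_eq, exists_prop]
  rw [h]
  refine MeasurableSet.iUnion fun k => MeasurableSet.iUnion fun l => MeasurableSet.iUnion fun _ =>
    MeasurableSet.inter ?_ ?_
  · exact (measurableSet_beam m k).preimage
      (measurable_fst.prodMk (measurable_snd.comp measurable_snd))
  · exact (measurableSet_beam m l).preimage measurable_snd

lemma swapSet_symm {m : ℕ} (u v : ℂ) (c : ℝ) (h : (u, v, c) ∈ swapSet m) :
    (v, u, c) ∈ swapSet m := by
  obtain ⟨k, l, hkl, hu, hv⟩ := h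
  exact ⟨l, k, hkl.symm, hv, hu⟩

lemma mul_mem_beam_iff {m : ℕ} {c : ℝ} {k : Fin (2 ^ m)} {r : ℝ} (hr : 0 < r) (w : ℂ) :
    (r : ℂ) * w ∈ beam m c k ↔ w ∈ beam m c k := by
  rw [mem_beam_iff_arg, mem_beam_iff_arg, Complex.arg_real_mul _ hr]
  simp [hr.ne']

lemma swapSet_scale {m : ℕ} {r : ℝ} (hr : 0 < r) (u v : ℂ) (c : ℝ) :
    ((r : ℂ) * u, (r : ℂ) * v, c) ∈ swapSet m ↔ (u, v, c) ∈ swapSet m := by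
  simp only [swapSet, mem_ofPred_eq, mul_mem_beam_iff hr]

/-- The panel number is read off from the angle by a floor; disjointness of the panels follows. -/
lemma panelInterval_eq_of_mem {m : ℕ} {c a : ℝ} {k : Fin (2 ^ m)} (h : a ∈ panelInterval m c k) :
    ⌊(a - c) / (2 * Real.pi / 2 ^ m)⌋ = (k : ℤ) := by
  have hpos : 0 < 2 * Real.pi / 2 ^ m := by positivity
  rw [Int.floor_eq_iff, le_div_iff₀ hpos, div_lt_iff₀ hpos]
  obtain ⟨h1, h2⟩ := h
  push_cast
  constructor
  · calc ((k : ℕ) : ℝ) * (2 * Real.pi / 2 ^ m) = 2 * (k : ℝ) * Real.pi / 2 ^ m := by ring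
      _ ≤ a - c := by linarith
  · calc a - c < 2 * ((k : ℝ) + 1) * Real.pi / 2 ^ m := by linarith
      _ = _ := by ring

lemma pairwise_disjoint_panelInterval (m : ℕ) (c : ℝ) :
    Pairwise (Function.onFun Disjoint (panelInterval m c)) := by
  intro k l hkl
  refine disjoint_left.2 fun a hk hl => hkl ?_
  have := (panelInterval_eq_of_mem hk).symm.trans (panelInterval_eq_of_mem hl)
  exact Fin.ext (by exact_mod_cast this)

lemma panelInterval_subset (m : ℕ) (c : ℝ) (k : Fin (2 ^ m)) :
    panelInterval m c k ⊆ Ico c (c + 2 * Real.pi) := by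
  rintro a ⟨h1, h2⟩
  have hk : (k : ℝ) + 1 ≤ 2 ^ m := by exact_mod_cast k.2
  have h3 : 0 ≤ 2 * (k : ℝ) * Real.pi / 2 ^ m := by positivity
  have h4 : 2 * ((k : ℝ) + 1) * Real.pi / 2 ^ m ≤ 2 * Real.pi := by
    rw [div_le_iff₀ (by positivity)]
    nlinarith [Real.pi_pos]
  exact ⟨by linarith, by linarith⟩

lemma iUnion_panelInterval (m : ℕ) (c : ℝ) :
    ⋃ k, panelInterval m c k = Ico c (c + 2 * Real.pi) := by
  refine subset_antisymm (iUnion_subset fun k => panelInterval_subset m c k) ?_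
  rintro a ⟨h1, h2⟩
  have hpos : 0 < 2 * Real.pi / 2 ^ m := by positivity
  have h0 : 0 ≤ (a - c) / (2 * Real.pi / 2 ^ m) := div_nonneg (by linarith) hpos.le
  have hlt : ⌊(a - c) / (2 * Real.pi / 2 ^ m)⌋₊ < 2 ^ m := by
    rw [Nat.floor_lt h0, div_lt_iff₀ hpos]
    push_cast
    field_simp
    linarith
  refine mem_iUnion.2 ⟨⟨_, hlt⟩, ?_, ?_⟩
  · have := (le_div_iff₀ hpos).1 (Nat.floor_le h0)
    calc c + 2 * (⌊(a - c) / (2 * Real.pi / 2 ^ m)⌋₊ : ℝ) * Real.pi / 2 ^ m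
        = c + (⌊(a - c) / (2 * Real.pi / 2 ^ m)⌋₊ : ℝ) * (2 * Real.pi / 2 ^ m) := by ring
      _ ≤ a := by linarith
  · have := (div_lt_iff₀ hpos).1 (Nat.lt_floor_add_one ((a - c) / (2 * Real.pi / 2 ^ m)))
    calc a < c + ((⌊(a - c) / (2 * Real.pi / 2 ^ m)⌋₊ : ℝ) + 1) * (2 * Real.pi / 2 ^ m) := by
          linarith
      _ = c + 2 * ((⌊(a - c) / (2 * Real.pi / 2 ^ m)⌋₊ : ℝ) + 1) * Real.pi / 2 ^ m := by ring

/-- All panel intervals lie in one half-open window of length `2π`, so no nonzero number of turns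
can lead from one to another. -/
lemma mem_panelAngles_iff_eq {m : ℕ} {c a : ℝ} {k l : Fin (2 ^ m)}
    (h : a ∈ panelInterval m c k) : a ∈ panelAngles m c l ↔ k = l := by
  constructor
  · rintro ⟨n, hn⟩
    have h1 := panelInterval_subset m c k h
    have h2 := panelInterval_subset m c l hn
    have hpi := Real.pi_pos
    have hn0 : n = 0 := by
      have hlt : (n : ℝ) < 1 := by
        by_contra! hge
        nlinarith [h1.1, h2.2]
      have hgt : (-1 : ℝ) < n := by
        by_contra! hge
        nlinarith [h1.2, h2.1]
      have a1 : n < 1 := by exact_mod_cast hlt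
      have a2 : -1 < n := by exact_mod_cast hgt
      omega
    subst hn0
    by_contra hkl
    refine disjoint_left.1 (pairwise_disjoint_panelInterval m c hkl) h ?_
    simpa using hn
  · rintro rfl
    exact ⟨0, by simpa using h⟩

lemma existsUnique_panelAngles (m : ℕ) (c a : ℝ) : ∃! k, a ∈ panelAngles m c k := by
  have hmem := toIcoMod_mem_Ico Real.two_pi_pos c a
  rw [← iUnion_panelInterval m c] at hmem
  obtain ⟨k, hk⟩ := mem_iUnion.1 hmem
  have hiff : ∀ l, a ∈ panelAngles m c l ↔ toIcoMod Real.two_pi_pos c a ∈ panelAngles m c l := by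
    intro l
    have he : toIcoMod Real.two_pi_pos c a = a - toIcoDiv Real.two_pi_pos c a * (2 * Real.pi) := by
      rw [toIcoMod, zsmul_eq_mul]
    constructor
    · rintro ⟨n, hn⟩
      refine ⟨n + toIcoDiv Real.two_pi_pos c a, ?_⟩
      rw [he]
      convert hn using 1
      push_cast; ring
    · rintro ⟨n, hn⟩
      refine ⟨n - toIcoDiv Real.two_pi_pos c a, ?_⟩
      rw [he] at hn
      convert hn using 1
      push_cast; ring
  exact ⟨k, (hiff k).2 ((mem_panelAngles_iff_eq hk).2 rfl), fun l hl =>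
    ((mem_panelAngles_iff_eq hk).1 ((hiff l).1 hl)).symm⟩

/-- The two directions of angles `a` and `b` are covered by the same panel. -/
def SamePanel (m : ℕ) (c a b : ℝ) : Prop := ∃ k, a ∈ panelAngles m c k ∧ b ∈ panelAngles m c k

lemma mem_swapSet_iff (m : ℕ) (c a b : ℝ) :
    (Complex.exp (a * Complex.I), Complex.exp (b * Complex.I), c) ∈ swapSet m ↔
      ¬ SamePanel m c a b := by
  have h := fun (a : ℝ) k => mem_beam_iff (m := m) (c := c) (k := k) one_pos a
  simp only [Complex.ofReal_one, one_mul] at h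
  simp only [swapSet, mem_ofPred_eq, h]
  obtain ⟨k, hk, hku⟩ := existsUnique_panelAngles m c a
  obtain ⟨l, hl, hlu⟩ := existsUnique_panelAngles m c b
  constructor
  · rintro ⟨k', l', hne, hk', hl'⟩ ⟨j, hj, hj'⟩
    exact hne ((hku k' hk').trans ((hku j hj).symm.trans
      ((hlu j hj').trans (hlu l' hl').symm)))
  · intro hns
    exact ⟨k, l, fun he => hns ⟨k, hk, he ▸ hl⟩, hk, hl⟩

lemma swapAtOrigin_seenFrom_iff (m : ℕ) (φ : Set ℂ) (c t : ℝ) :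
    SwapAtOrigin m (seenFrom t φ) c ↔
      ∃ x y, AreNeighborsAt φ (t : ℂ) x y ∧ (x - t, y - t, c) ∈ swapSet m := by
  have hd : ∀ z : ℂ, dist (0 : ℂ) (z - t) = dist (t : ℂ) z := by
    intro z
    rw [dist_comm, dist_zero_right, dist_comm, dist_eq_norm]
  have hv : ∀ x, (0 : ℂ) ∈ voronoiCell (seenFrom t φ) (x - t) ↔ (t : ℂ) ∈ voronoiCell φ x := by
    intro x
    simp only [voronoiCell, seenFrom, mem_ofPred_eq, forall_mem_image, hd]
  constructor
  · rintro ⟨_, _, ⟨⟨x, hx, rfl⟩, ⟨y, hy, rfl⟩, hne, h1, h2⟩, hs⟩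
    exact ⟨x, y, ⟨hx, hy, fun h => hne (by rw [h]), (hv x).1 h1, (hv y).1 h2⟩, hs⟩
  · rintro ⟨x, y, ⟨hx, hy, hne, h1, h2⟩, hs⟩
    exact ⟨x - t, y - t, ⟨⟨x, hx, rfl⟩, ⟨y, hy, rfl⟩, fun h => hne (sub_left_injective h),
      (hv x).2 h1, (hv y).2 h2⟩, hs⟩

lemma handovers_swap_eq (m : ℕ) (φ : Set ℂ) (c : ℝ) :
    {t ∈ handovers φ ∩ Icc 0 1 | SwapAtOrigin m (seenFrom t φ) c} =
      handoversIn (swapSet m) φ c := by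
  ext t
  simp only [handoversIn, mem_ofPred_eq, swapAtOrigin_seenFrom_iff]
  constructor
  · exact fun h => ⟨h.1.2, h.2⟩
  · rintro ⟨ht, x, y, hxy, hs⟩
    exact ⟨⟨⟨x, y, hxy⟩, ht⟩, x, y, hxy, hs⟩

lemma handovers_inter_eq (φ : Set ℂ) (c : ℝ) :
    handovers φ ∩ Icc 0 1 = handoversIn univ φ c := by
  ext t
  simp only [handoversIn, handovers, mem_inter_iff, mem_ofPred_eq, mem_univ, and_true]
  exact and_comm

/-! ### Trigonometric integrals over sectors -/

lemma setLIntegral_Ioc_of_continuous {f : ℝ → ℝ} (hf : Continuous f) {a b : ℝ} (hab : a ≤ b)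
    (h0 : ∀ x ∈ Ioc a b, 0 ≤ f x) :
    ∫⁻ x in Ioc a b, ENNReal.ofReal (f x) = ENNReal.ofReal (∫ x in a..b, f x) := by
  rw [intervalIntegral.integral_of_le hab, ofReal_integral_eq_lintegral_ofReal]
  · exact (hf.intervalIntegrable a b).1
  · exact (ae_restrict_iff' measurableSet_Ioc).2 (.of_forall h0)

lemma setLIntegral_Ioc_add (F : ℝ → ℝ≥0∞) (a b s : ℝ) :
    ∫⁻ x in Ioc (s + a) (s + b), F x = ∫⁻ x in Ioc a b, F (s + x) := by
  have h := (measurePreserving_add_left volume s).setLIntegral_comp_preimage_emb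
    (measurableEmbedding_addLeft s) F (Ioc (s + a) (s + b))
  rw [← h]
  simp

lemma setLIntegral_Ioc_periodic {F : ℝ → ℝ≥0∞} {T : ℝ} (hT : 0 < T) (hF : Function.Periodic F T)
    (a b : ℝ) : ∫⁻ x in Ioc a (a + T), F x = ∫⁻ x in Ioc b (b + T), F x := by
  refine (isAddFundamentalDomain_Ioc hT a).setLIntegral_eq (isAddFundamentalDomain_Ioc hT b) F ?_
  intro g x
  obtain ⟨n, hn⟩ := AddSubgroup.mem_zmultiples_iff.1 g.2
  rw [AddSubgroup.vadd_def, vadd_eq_add, ← hn, add_comm]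
  exact hF.zsmul n x

lemma integral_abs_sin_add (w : ℝ) : ∫ s in (0 : ℝ)..Real.pi, |Real.sin (s + w)| = 2 := by
  have hper : Function.Periodic (fun s => |Real.sin s|) Real.pi := by
    intro s; simp [Real.sin_add_pi]
  rw [intervalIntegral.integral_comp_add_right (fun s => |Real.sin s|), zero_add, add_comm,
    hper.intervalIntegral_add_eq w 0, zero_add]
  rw [intervalIntegral.integral_congr (g := Real.sin)]
  · simp [integral_sin]; norm_num
  · intro s hs
    rw [uIcc_of_le Real.pi_pos.le] at hs
    exact abs_of_nonneg (Real.sin_nonneg_of_nonneg_of_le_pi hs.1 hs.2)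

lemma abs_cos_sub_cos (s u v : ℝ) :
    |Real.cos (s + v) - Real.cos (s + u)| =
      2 * |Real.sin ((u - v) / 2)| * |Real.sin (s + (u + v) / 2)| := by
  rw [Real.cos_sub_cos, abs_mul, abs_mul, abs_neg, abs_two,
    show (s + v - (s + u)) / 2 = -((u - v) / 2) by ring, Real.sin_neg, abs_neg,
    show (s + v + (s + u)) / 2 = s + (u + v) / 2 by ring]
  ring

lemma lintegral_abs_cos_sub_cos (u v : ℝ) :
    ∫⁻ s in Ioc 0 Real.pi, ENNReal.ofReal |Real.cos (s + v) - Real.cos (s + u)| =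
      ENNReal.ofReal (4 * |Real.sin ((u - v) / 2)|) := by
  rw [setLIntegral_Ioc_of_continuous (by fun_prop) Real.pi_pos.le fun _ _ => abs_nonneg _]
  congr 1
  simp_rw [abs_cos_sub_cos]
  rw [intervalIntegral.integral_const_mul, integral_abs_sin_add]
  ring

lemma integral_sin_half_sub (u a b : ℝ) :
    ∫ v in a..b, Real.sin ((u - v) / 2) = 2 * Real.cos ((u - b) / 2) - 2 * Real.cos ((u - a) / 2) := by
  rw [intervalIntegral.integral_eq_sub_of_hasDerivAt (f := fun v => 2 * Real.cos ((u - v) / 2))]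
  · intro v _
    have h := ((((hasDerivAt_id v).const_sub u).div_const 2).cos).const_mul 2
    refine h.congr_deriv ?_
    simp only [id]
    ring
  · exact (by fun_prop : Continuous fun v => Real.sin ((u - v) / 2)).intervalIntegrable _ _

/-- The bound `d ≤ 2π` keeps `(u - v)/2` in `[-π, π]`, where the sine changes sign only at `v = u`.
-/
lemma integral_abs_sin_half_sub {d u : ℝ} (hd : d ≤ 2 * Real.pi) (h0 : 0 ≤ u) (hu : u ≤ d) :
    ∫ v in (0 : ℝ)..d, |Real.sin ((u - v) / 2)| =
      4 - 2 * Real.cos (u / 2) - 2 * Real.cos ((d - u) / 2) := by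
  have hint : ∀ a b, IntervalIntegrable (fun v => |Real.sin ((u - v) / 2)|) volume a b :=
    fun a b => (by fun_prop : Continuous fun v => |Real.sin ((u - v) / 2)|).intervalIntegrable _ _
  rw [← intervalIntegral.integral_add_adjacent_intervals (hint 0 u) (hint u d)]
  have e1 : ∫ v in (0 : ℝ)..u, |Real.sin ((u - v) / 2)| = ∫ v in (0 : ℝ)..u, Real.sin ((u - v) / 2) := by
    refine intervalIntegral.integral_congr fun v hv => ?_
    rw [uIcc_of_le h0] at hv
    exact abs_of_nonneg (Real.sin_nonneg_of_nonneg_of_le_pi (by linarith [hv.2])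
      (by linarith [hv.1]))
  have e2 : ∫ v in u..d, |Real.sin ((u - v) / 2)| = ∫ v in u..d, -Real.sin ((u - v) / 2) := by
    refine intervalIntegral.integral_congr fun v hv => ?_
    rw [uIcc_of_le hu] at hv
    exact abs_of_nonpos (Real.sin_nonpos_of_nonpos_of_neg_pi_le (by linarith [hv.1])
      (by linarith [hv.2]))
  rw [e1, e2, intervalIntegral.integral_neg, integral_sin_half_sub, integral_sin_half_sub,
    ← Real.cos_neg ((u - d) / 2)]
  simp only [sub_self, zero_div, Real.cos_zero, sub_zero]
  rw [show -((u - d) / 2) = (d - u) / 2 by ring]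
  ring

lemma integral_cos_half (d : ℝ) :
    ∫ u in (0 : ℝ)..d, (4 - 2 * Real.cos (u / 2) - 2 * Real.cos ((d - u) / 2)) =
      4 * d - 8 * Real.sin (d / 2) := by
  rw [intervalIntegral.integral_eq_sub_of_hasDerivAt
    (f := fun u => 4 * u - 4 * Real.sin (u / 2) + 4 * Real.sin ((d - u) / 2))]
  · simp; ring
  · intro u _
    have h1 := (((hasDerivAt_id u).div_const 2).sin).const_mul 4
    have h2 := ((((hasDerivAt_id u).const_sub d).div_const 2).sin).const_mul 4
    refine ((((hasDerivAt_id u).const_mul 4).sub h1).add h2).congr_deriv ?_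
    simp only [id]
    ring
  · exact (by fun_prop : Continuous fun u =>
      4 - 2 * Real.cos (u / 2) - 2 * Real.cos ((d - u) / 2)).intervalIntegrable _ _

/-- The total weight of the pairs of directions in the sector `(s, s + d]`. -/
noncomputable def sectorWeight (d s : ℝ) : ℝ≥0∞ :=
  ∫⁻ a in Ioc s (s + d), ∫⁻ b in Ioc s (s + d), ENNReal.ofReal (Real.cos b - Real.cos a)

lemma sectorWeight_eq (d s : ℝ) :
    sectorWeight d s =
      ∫⁻ u in Ioc 0 d, ∫⁻ v in Ioc 0 d, ENNReal.ofReal (Real.cos (s + v) - Real.cos (s + u)) := by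
  have h := fun F => setLIntegral_Ioc_add F 0 d s
  simp only [add_zero] at h
  simp only [sectorWeight, h]

lemma sectorWeight_eq_swap (d s : ℝ) :
    sectorWeight d s =
      ∫⁻ u in Ioc 0 d, ∫⁻ v in Ioc 0 d, ENNReal.ofReal (Real.cos (s + u) - Real.cos (s + v)) := by
  rw [sectorWeight_eq, lintegral_lintegral_swap]
  exact Measurable.aemeasurable (by fun_prop)

/-- A rotation by `π` negates both cosines, which amounts to exchanging the two directions. -/
lemma periodic_sectorWeight (d : ℝ) : Function.Periodic (sectorWeight d) Real.pi := by
  intro s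
  rw [sectorWeight_eq, sectorWeight_eq_swap]
  have h : ∀ u, Real.cos (s + Real.pi + u) = -Real.cos (s + u) := by
    intro u; rw [← Real.cos_add_pi]; ring_nf
  simp_rw [h]
  congr! 5
  ring

/-- The two forms of the weight, with the variables exchanged, are the positive and negative parts
of the same difference. -/
lemma two_mul_sectorWeight (d s : ℝ) :
    2 * sectorWeight d s =
      ∫⁻ u in Ioc 0 d, ∫⁻ v in Ioc 0 d, ENNReal.ofReal |Real.cos (s + v) - Real.cos (s + u)| := by
  rw [two_mul]
  nth_rewrite 2 [sectorWeight_eq_swap]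
  rw [sectorWeight_eq, ← lintegral_add_left]
  · refine lintegral_congr fun u => ?_
    rw [← lintegral_add_left (by fun_prop)]
    refine lintegral_congr fun v => ?_
    rcases le_total (Real.cos (s + v)) (Real.cos (s + u)) with h | h
    · rw [ENNReal.ofReal_of_nonpos (by linarith), zero_add, abs_of_nonpos (by linarith), neg_sub]
    · rw [ENNReal.ofReal_of_nonpos (p := Real.cos (s + u) - _) (by linarith), add_zero,
        abs_of_nonneg (by linarith)]
  · exact Measurable.lintegral_prod_right' (f := fun p : ℝ × ℝ =>
      ENNReal.ofReal (Real.cos (s + p.2) - Real.cos (s + p.1))) (by fun_prop)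

/-- Integrating over the orientation `s` first leaves `4 |sin ((u - v)/2)|`, whose double integral
over the square of side `d` is elementary. The factor 2 accounts for the passage to absolute values.
-/
lemma lintegral_sectorWeight {d : ℝ} (h0 : 0 ≤ d) (hd : d ≤ 2 * Real.pi) :
    ∫⁻ s in Ioc 0 Real.pi, sectorWeight d s = ENNReal.ofReal (8 * d - 16 * Real.sin (d / 2)) := by
  have h2 : 2 * ∫⁻ s in Ioc 0 Real.pi, sectorWeight d s =
      ENNReal.ofReal (4 * (4 * d - 8 * Real.sin (d / 2))) := by
    rw [← lintegral_const_mul' _ _ (by simp)]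
    simp_rw [two_mul_sectorWeight]
    rw [lintegral_lintegral_swap]
    · have e : ∀ u, ∫⁻ s in Ioc 0 Real.pi, ∫⁻ v in Ioc 0 d,
          ENNReal.ofReal |Real.cos (s + v) - Real.cos (s + u)| =
          ∫⁻ v in Ioc 0 d, ENNReal.ofReal (4 * |Real.sin ((u - v) / 2)|) := by
        intro u
        rw [lintegral_lintegral_swap]
        · simp_rw [lintegral_abs_cos_sub_cos]
        · exact Measurable.aemeasurable (by fun_prop)
      simp_rw [e]
      have e2 : ∀ u ∈ Ioc 0 d, ∫⁻ v in Ioc 0 d, ENNReal.ofReal (4 * |Real.sin ((u - v) / 2)|) =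
          ENNReal.ofReal (4 * (4 - 2 * Real.cos (u / 2) - 2 * Real.cos ((d - u) / 2))) := by
        intro u hu
        rw [setLIntegral_Ioc_of_continuous (by fun_prop) h0 fun _ _ => by positivity,
          intervalIntegral.integral_const_mul, integral_abs_sin_half_sub hd hu.1.le hu.2]
      rw [setLIntegral_congr_fun measurableSet_Ioc e2,
        setLIntegral_Ioc_of_continuous (by fun_prop) h0, intervalIntegral.integral_const_mul,
        integral_cos_half]
      intro u _
      have := Real.cos_le_one (u / 2)
      have := Real.cos_le_one ((d - u) / 2)
      linarith
    · exact Measurable.aemeasurable (Measurable.lintegral_prod_right'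
        (f := fun p : (ℝ × ℝ) × ℝ =>
          ENNReal.ofReal |Real.cos (p.1.1 + p.2) - Real.cos (p.1.1 + p.1.2)|) (by fun_prop))
  have h3 : (2 : ℝ≥0∞) * ENNReal.ofReal (8 * d - 16 * Real.sin (d / 2)) =
      ENNReal.ofReal (4 * (4 * d - 8 * Real.sin (d / 2))) := by
    rw [← ENNReal.ofReal_ofNat 2, ← ENNReal.ofReal_mul (by norm_num)]
    congr 1; ring
  rw [← h3] at h2
  exact (ENNReal.mul_right_inj (by simp) (by simp)).1 h2

lemma measurable_sectorWeight (d : ℝ) : Measurable (sectorWeight d) := by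
  have h : sectorWeight d = fun s => ∫⁻ u in Ioc 0 d, ∫⁻ v in Ioc 0 d,
      ENNReal.ofReal (Real.cos (s + v) - Real.cos (s + u)) := funext (sectorWeight_eq d)
  rw [h]
  refine Measurable.lintegral_prod_right' (f := fun p : ℝ × ℝ => ∫⁻ v in Ioc 0 d,
      ENNReal.ofReal (Real.cos (p.1 + v) - Real.cos (p.1 + p.2))) ?_
  exact Measurable.lintegral_prod_right' (f := fun p : (ℝ × ℝ) × ℝ =>
      ENNReal.ofReal (Real.cos (p.1.1 + p.2) - Real.cos (p.1.1 + p.1.2))) (by fun_prop)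

lemma samePanel_add_left {m : ℕ} {c a b : ℝ} :
    SamePanel m c (a + 2 * Real.pi) b ↔ SamePanel m c a b := by
  simp only [SamePanel, panelAngles_add_two_pi]

lemma samePanel_add_right {m : ℕ} {c a b : ℝ} :
    SamePanel m c a (b + 2 * Real.pi) ↔ SamePanel m c a b := by
  simp only [SamePanel, panelAngles_add_two_pi]

lemma measurableSet_panelInterval (m : ℕ) (c : ℝ) (k : Fin (2 ^ m)) :
    MeasurableSet (panelInterval m c k) := measurableSet_Ico

lemma setLIntegral_panelInterval (m : ℕ) (c : ℝ) (k : Fin (2 ^ m)) (F : ℝ → ℝ≥0∞) :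
    ∫⁻ x in panelInterval m c k, F x =
      ∫⁻ x in Ioc (c + k * (2 * Real.pi / 2 ^ m))
        (c + k * (2 * Real.pi / 2 ^ m) + 2 * Real.pi / 2 ^ m), F x := by
  rw [panelInterval, restrict_Ico_eq_restrict_Ioc]
  congr 3 <;> ring

lemma setLIntegral_Ioc_eq_Ico {F : ℝ → ℝ≥0∞} (hF : Function.Periodic F (2 * Real.pi)) (c : ℝ) :
    ∫⁻ x in Ioc (-Real.pi) Real.pi, F x = ∫⁻ x in Ico c (c + 2 * Real.pi), F x := by
  rw [restrict_Ico_eq_restrict_Ioc, ← setLIntegral_Ioc_periodic Real.two_pi_pos hF (-Real.pi)]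
  congr 3
  ring

-- Periodicity moves both integrals to the window `[c, c + 2π)`, which the panel intervals tile; two
-- directions there share a panel exactly when they fall in the same tile.
open Classical in
lemma lintegral_samePanel (m : ℕ) (c : ℝ) :
    ∫⁻ a in Ioc (-Real.pi) Real.pi, ∫⁻ b in Ioc (-Real.pi) Real.pi,
      ENNReal.ofReal (Real.cos b - Real.cos a) * (if SamePanel m c a b then 1 else 0) =
    ∑ k : Fin (2 ^ m), sectorWeight (2 * Real.pi / 2 ^ m) (c + k * (2 * Real.pi / 2 ^ m)) := by
  have p2 : ∀ a, Function.Periodic (fun b => ENNReal.ofReal (Real.cos b - Real.cos a) *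
      (if SamePanel m c a b then (1 : ℝ≥0∞) else 0)) (2 * Real.pi) := by
    intro a b
    simp only [Real.cos_add_two_pi, samePanel_add_right]
  have p1 : Function.Periodic (fun a => ∫⁻ b in Ioc (-Real.pi) Real.pi,
      ENNReal.ofReal (Real.cos b - Real.cos a) *
        (if SamePanel m c a b then (1 : ℝ≥0∞) else 0)) (2 * Real.pi) := by
    intro a
    simp only [Real.cos_add_two_pi, samePanel_add_left]
  rw [setLIntegral_Ioc_eq_Ico p1 c, ← iUnion_panelInterval m c,
    lintegral_iUnion (measurableSet_panelInterval m c) (pairwise_disjoint_panelInterval m c),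
    tsum_fintype]
  refine Finset.sum_congr rfl fun k _ => ?_
  rw [sectorWeight, ← setLIntegral_panelInterval]
  refine setLIntegral_congr_fun (measurableSet_panelInterval m c k) fun a ha => ?_
  rw [← setLIntegral_panelInterval, setLIntegral_Ioc_eq_Ico (p2 a) c]
  have e : ∀ b ∈ Ico c (c + 2 * Real.pi), ENNReal.ofReal (Real.cos b - Real.cos a) *
      (if SamePanel m c a b then (1 : ℝ≥0∞) else 0) =
      (panelInterval m c k).indicator (fun b => ENNReal.ofReal (Real.cos b - Real.cos a)) b := by
    intro b hb
    rw [← iUnion_panelInterval m c] at hb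
    obtain ⟨l, hl⟩ := mem_iUnion.1 hb
    have hs : SamePanel m c a b ↔ k = l := by
      constructor
      · rintro ⟨j, hj, hj'⟩
        exact ((mem_panelAngles_iff_eq ha).1 hj).trans ((mem_panelAngles_iff_eq hl).1 hj').symm
      · rintro rfl
        exact ⟨k, (mem_panelAngles_iff_eq ha).2 rfl, (mem_panelAngles_iff_eq hl).2 rfl⟩
    by_cases hkl : k = l
    · rw [if_pos (hs.2 hkl), mul_one, indicator_of_mem (hkl ▸ hl)]
    · rw [if_neg (fun h => hkl (hs.1 h)), mul_zero, indicator_of_notMem]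
      exact fun hk => disjoint_left.1 (pairwise_disjoint_panelInterval m c hkl) hk hl
  rw [setLIntegral_congr_fun measurableSet_Ico e,
    setLIntegral_indicator (measurableSet_panelInterval m c k),
    inter_eq_left.2 (panelInterval_subset m c k)]

lemma lintegral_sum_sectorWeight (m : ℕ) :
    ∫⁻ c in Ioc 0 Real.pi, ∑ k : Fin (2 ^ m),
      sectorWeight (2 * Real.pi / 2 ^ m) (c + k * (2 * Real.pi / 2 ^ m)) =
    ENNReal.ofReal (16 * Real.pi - 16 * (2 ^ m * Real.sin (Real.pi / 2 ^ m))) := by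
  have hd : 2 * Real.pi / 2 ^ m ≤ 2 * Real.pi :=
    div_le_self Real.two_pi_pos.le (one_le_pow₀ (by norm_num))
  have hk : ∀ w : ℝ, ∫⁻ c in Ioc 0 Real.pi, sectorWeight (2 * Real.pi / 2 ^ m) (c + w) =
      ENNReal.ofReal (8 * (2 * Real.pi / 2 ^ m) - 16 * Real.sin (Real.pi / 2 ^ m)) := by
    intro w
    have h := setLIntegral_Ioc_add (sectorWeight (2 * Real.pi / 2 ^ m)) 0 Real.pi w
    simp_rw [add_comm _ w]
    rw [← h, add_zero, setLIntegral_Ioc_periodic Real.pi_pos (periodic_sectorWeight _) w 0,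
      zero_add, lintegral_sectorWeight (by positivity) hd]
    congr 4
    ring
  have hm : ∀ w : ℝ, Measurable fun c => sectorWeight (2 * Real.pi / 2 ^ m) (c + w) :=
    fun w => (measurable_sectorWeight _).comp (measurable_add_const w)
  rw [lintegral_finsetSum _ fun k _ => hm _]
  simp_rw [hk]
  rw [Finset.sum_const, Finset.card_univ, Fintype.card_fin, ← ENNReal.ofReal_nsmul]
  congr 1
  rw [nsmul_eq_mul]
  push_cast
  field_simp
  ring

/-! ### Angular weights averaged over the panel orientation -/

/-- The law of the first boundary of the panels. -/
noncomputable abbrev panelLaw : Measure ℝ := ProbabilityTheory.cond volume (Icc 0 Real.pi)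

/-- The weight of the pairs of directions seen in `A`. -/
noncomputable def angularWeight (A : Set (ℂ × ℂ × ℝ)) : ℝ≥0∞ :=
  ∫⁻ a in Ioc (-Real.pi) Real.pi, ∫⁻ b in Ioc (-Real.pi) Real.pi,
    ENNReal.ofReal (Real.cos b - Real.cos a) *
      panelLaw {c | (Complex.exp (a * Complex.I), Complex.exp (b * Complex.I), c) ∈ A}

instance : IsProbabilityMeasure panelLaw :=
  cond_isProbabilityMeasure_of_finite (by simp [Real.pi_pos]) (by simp)

lemma measurable_unitPair :
    Measurable fun p : (ℝ × ℝ) × ℝ =>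
      (Complex.exp (p.1.1 * Complex.I), Complex.exp (p.1.2 * Complex.I), p.2) := by
  fun_prop

lemma measurable_angularWeight_integrand {A : Set (ℂ × ℂ × ℝ)} (hA : MeasurableSet A) :
    Measurable fun p : ℝ × ℝ => ENNReal.ofReal (Real.cos p.2 - Real.cos p.1) *
      panelLaw {c | (Complex.exp (p.1 * Complex.I), Complex.exp (p.2 * Complex.I), c) ∈ A} :=
  Measurable.mul (by fun_prop)
    (measurable_measure_prodMk_left (hA.preimage measurable_unitPair))

lemma angularWeight_compl_swapSet (m : ℕ) :
    angularWeight (swapSet m)ᶜ =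
      ENNReal.ofReal (16 - 16 * (2 ^ m / Real.pi * Real.sin (Real.pi / 2 ^ m))) := by
  classical
  have mS : MeasurableSet {p : (ℝ × ℝ) × ℝ | SamePanel m p.2 p.1.1 p.1.2} := by
    convert (measurableSet_swapSet m).compl.preimage measurable_unitPair using 1
    ext p
    simp only [mem_ofPred_eq, mem_preimage, mem_compl_iff, mem_swapSet_iff, not_not]
  have mF : Measurable fun p : (ℝ × ℝ) × ℝ => ENNReal.ofReal (Real.cos p.1.2 - Real.cos p.1.1) *
      (if SamePanel m p.2 p.1.1 p.1.2 then (1 : ℝ≥0∞) else 0) :=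
    Measurable.mul (by fun_prop) (Measurable.ite mS measurable_const measurable_const)
  have e1 : ∀ a b : ℝ, ENNReal.ofReal (Real.cos b - Real.cos a) * panelLaw
      {c | (Complex.exp (a * Complex.I), Complex.exp (b * Complex.I), c) ∈ (swapSet m)ᶜ} =
      ∫⁻ c, ENNReal.ofReal (Real.cos b - Real.cos a) *
        (if SamePanel m c a b then (1 : ℝ≥0∞) else 0) ∂panelLaw := by
    intro a b
    rw [lintegral_const_mul' _ _ ENNReal.ofReal_ne_top]
    congr 1
    have hs : {c | (Complex.exp (a * Complex.I), Complex.exp (b * Complex.I), c) ∈ (swapSet m)ᶜ} =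
        {c | SamePanel m c a b} := by
      ext c
      simp only [mem_ofPred_eq, mem_compl_iff, mem_swapSet_iff, not_not]
    have ms : MeasurableSet {c | SamePanel m c a b} :=
      mS.preimage (f := fun c => ((a, b), c)) (by fun_prop)
    rw [hs, ← lintegral_indicator_one ms]
    simp [indicator_apply]
  have e2 : angularWeight (swapSet m)ᶜ = ∫⁻ c, (∫⁻ a in Ioc (-Real.pi) Real.pi,
      ∫⁻ b in Ioc (-Real.pi) Real.pi, ENNReal.ofReal (Real.cos b - Real.cos a) *
        (if SamePanel m c a b then (1 : ℝ≥0∞) else 0)) ∂panelLaw := by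
    simp only [angularWeight, e1]
    symm
    rw [lintegral_lintegral_swap]
    · refine lintegral_congr fun a => ?_
      rw [lintegral_lintegral_swap]
      exact (mF.comp (f := fun p : ℝ × ℝ => ((a, p.2), p.1)) (by fun_prop)).aemeasurable
    · refine Measurable.aemeasurable ?_
      exact Measurable.lintegral_prod_right' (f := fun p : (ℝ × ℝ) × ℝ =>
        ENNReal.ofReal (Real.cos p.2 - Real.cos p.1.2) *
        (if SamePanel m p.1.1 p.1.2 p.2 then (1 : ℝ≥0∞) else 0))
        (mF.comp (f := fun p : (ℝ × ℝ) × ℝ => ((p.1.2, p.2), p.1.1)) (by fun_prop))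
  rw [e2]
  simp_rw [lintegral_samePanel]
  rw [panelLaw, ProbabilityTheory.cond, lintegral_smul_measure, Measure.restrict_congr_set Ioc_ae_eq_Icc.symm,
    lintegral_sum_sectorWeight, Real.volume_Icc, sub_zero, smul_eq_mul,
    ← ENNReal.ofReal_inv_of_pos Real.pi_pos, ← ENNReal.ofReal_mul (by positivity)]
  congr 1
  have := Real.pi_ne_zero
  field_simp

lemma swapSet_zero : swapSet 0 = ∅ := by
  ext s
  simp only [swapSet, mem_ofPred_eq, mem_empty_iff_false, iff_false]
  rintro ⟨k, l, hkl, -⟩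
  exact hkl (Subsingleton.elim (α := Fin 1) k l)

/-- The total is read off from the case `m = 0`: a single panel never swaps, and `sin π = 0`. -/
lemma angularWeight_univ : angularWeight univ = 16 := by
  have h := angularWeight_compl_swapSet 0
  rw [swapSet_zero, compl_empty] at h
  simpa using h

lemma angularWeight_swapSet (m : ℕ) :
    angularWeight (swapSet m) =
      ENNReal.ofReal (16 * (2 ^ m / Real.pi * Real.sin (Real.pi / 2 ^ m))) := by
  have hpi := Real.pi_pos
  have hadd : angularWeight (swapSet m) + angularWeight (swapSet m)ᶜ = angularWeight univ := by
    have mS := measurable_angularWeight_integrand (measurableSet_swapSet m)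
    simp only [angularWeight]
    rw [← lintegral_add_left mS.lintegral_prod_right']
    refine lintegral_congr fun a => ?_
    refine (lintegral_add_left (mS.comp (f := fun b => (a, b)) (by fun_prop)) _).symm.trans ?_
    refine lintegral_congr fun b => ?_
    simp only [Function.comp_apply]
    rw [← mul_add]
    congr 1
    have ms : MeasurableSet
        {c | (Complex.exp (a * Complex.I), Complex.exp (b * Complex.I), c) ∈ swapSet m} :=
      (measurableSet_swapSet m).preimage (f := fun c : ℝ =>
        (Complex.exp (a * Complex.I), Complex.exp (b * Complex.I), c)) (by fun_prop)
    exact (measure_add_measure_compl ms).trans (by simp)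
  have hsin : 0 ≤ Real.sin (Real.pi / 2 ^ m) :=
    Real.sin_nonneg_of_nonneg_of_le_pi (by positivity)
      (div_le_self hpi.le (one_le_pow₀ (by norm_num)))
  -- This bound, from `sin x ≤ x`, makes the complementary weight nonnegative, so that
  -- `ENNReal.ofReal` does not truncate it.
  have hle : 2 ^ m / Real.pi * Real.sin (Real.pi / 2 ^ m) ≤ 1 := by
    calc 2 ^ m / Real.pi * Real.sin (Real.pi / 2 ^ m)
        ≤ 2 ^ m / Real.pi * (Real.pi / 2 ^ m) := by
          gcongr
          exact Real.sin_le (by positivity)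
      _ = 1 := by field_simp
  rw [angularWeight_univ, angularWeight_compl_swapSet] at hadd
  have h16 : (16 : ℝ≥0∞) =
      ENNReal.ofReal (16 * (2 ^ m / Real.pi * Real.sin (Real.pi / 2 ^ m))) +
      ENNReal.ofReal (16 - 16 * (2 ^ m / Real.pi * Real.sin (Real.pi / 2 ^ m))) := by
    rw [← ENNReal.ofReal_add (by positivity) (by linarith)]
    simp
  rw [h16] at hadd
  exact (ENNReal.add_left_inj ENNReal.ofReal_ne_top).1 hadd

/-! ### Radial factor and conclusion -/

/-- The radial integral in the mean number of handovers. -/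
noncomputable def radialWeight (L : ℝ) : ℝ≥0∞ :=
  ∫⁻ r in Ioi (0 : ℝ), ENNReal.ofReal (r ^ 2 * Real.exp (-(L * r ^ 2)))

lemma radialWeight_ne_top {L : ℝ} (hL : 0 < L) : radialWeight L ≠ ∞ := by
  have h := (integrableOn_rpow_mul_exp_neg_mul_sq hL (s := 2) (by norm_num)).lintegral_lt_top
  simp only [Real.rpow_two, neg_mul] at h
  exact h.ne

lemma radialWeight_ne_zero (L : ℝ) : radialWeight L ≠ 0 := by
  intro h
  rw [radialWeight, lintegral_eq_zero_iff (by fun_prop)] at h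
  have h2 := (ae_restrict_iff' measurableSet_Ioi).1 h
  have h3 : volume (Ioi (0 : ℝ)) = 0 := by
    refine measure_mono_null (fun r hr => ?_) h2
    simp only [mem_compl_iff, mem_ofPred_eq, Classical.not_imp]
    refine ⟨hr, ?_⟩
    have hr : (0 : ℝ) < r := hr
    simp only [Pi.zero_apply, ENNReal.ofReal_eq_zero, not_le]
    positivity
  simp at h3

namespace IsPoissonProcess

variable {Ω : Type*} [MeasurableSpace Ω] {P : Measure Ω} {lam : ℝ≥0}
  {Φ : Ω → Set ℂ} {χ : Ω → ℝ}

/-- The mean number of handovers in `[0, 1]` whose base stations and mark are seen in a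
scale invariant set. -/
theorem lintegral_handoversIn_eq [IsProbabilityMeasure P] (hΦ : IsPoissonProcess P lam Φ)
    (hχ : Measurable χ) (hlaw : P.map χ = panelLaw)
    (hindep : Indep (configSigma Φ) (MeasurableSpace.comap χ inferInstance) P)
    {A : Set (ℂ × ℂ × ℝ)} (hAm : MeasurableSet A) (hA : ∀ u v c, (u, v, c) ∈ A → (v, u, c) ∈ A)
    (hscale : ∀ (r : ℝ) (u v : ℂ) (c : ℝ), 0 < r →
      (((r : ℂ) * u, (r : ℂ) * v, c) ∈ A ↔ (u, v, c) ∈ A)) :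
    ∫⁻ ω, ((handoversIn A (Φ ω) (χ ω)).encard : ℝ≥0∞) ∂P =
      lam ^ 2 * (radialWeight (lam * Real.pi) * angularWeight A) := by
  rw [hΦ.lintegral_handoversIn hχ hindep hAm hA, hlaw]
  congr 1
  have mq : Measurable (Function.uncurry fun u v : ℂ => panelLaw {c | (u, v, c) ∈ A}) :=
    measurable_measure_prodMk_left (hAm.preimage
      (f := fun p : (ℂ × ℂ) × ℝ => (p.1.1, p.1.2, p.2)) (by fun_prop))
  have mG : Measurable (Function.uncurry fun u v : ℂ =>
      ENNReal.ofReal (Real.exp (-(lam * Real.pi * ‖u‖ ^ 2))) * panelLaw {c | (u, v, c) ∈ A}) :=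
    Measurable.mul (by fun_prop) mq
  have h1 := lintegral_pairs mG
  have h2 := lintegral_stationWeight mq (fun r u v hr => by simp only [hscale r u v _ hr])
    (lam * Real.pi)
  rw [h2] at h1
  simp only [dist_comm _, dist_eq_norm]
  exact h1

end IsPoissonProcess

end PanelSwap

theorem mainTheorem4 {Ω : Type*} [MeasurableSpace Ω] (P : Measure Ω) [IsProbabilityMeasure P]
    (lam : ℝ≥0) (hlam : 0 < lam)
    (Φ : Ω → Set ℂ) (hΦ : PanelSwap.IsPoissonProcess P lam Φ)
    (χ : Ω → ℝ) (hχ : Measurable χ)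
    (hχ_unif : pdf.IsUniform χ (Icc 0 Real.pi) P volume)
    (hindep : Indep (PanelSwap.configSigma Φ) (MeasurableSpace.comap χ inferInstance) P) :
    0 < PanelSwap.handoverIntensity P Φ ∧ PanelSwap.handoverIntensity P Φ < ∞ ∧
    (∀ m : ℕ, 1 ≤ m → PanelSwap.palmProb P Φ χ (PanelSwap.SwapAtOrigin m) =
      ENNReal.ofReal (2 ^ m / Real.pi * Real.sin (Real.pi / 2 ^ m))) ∧
    PanelSwap.palmProb P Φ χ (PanelSwap.SwapAtOrigin 1) = ENNReal.ofReal (2 / Real.pi) := by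
  have hL : 0 < (lam : ℝ) * Real.pi := mul_pos (by exact_mod_cast hlam) Real.pi_pos
  have hR := PanelSwap.radialWeight_ne_top hL
  have hR0 := PanelSwap.radialWeight_ne_zero ((lam : ℝ) * Real.pi)
  have hlam0 : (lam : ℝ≥0∞) ≠ 0 := by simpa using hlam.ne'
  -- The common factor of numerator and denominator of the Palm probability; it cancels because it
  -- is neither 0 nor infinite.
  set K : ℝ≥0∞ := lam ^ 2 * PanelSwap.radialWeight (lam * Real.pi) with hK
  have hK0 : K ≠ 0 := mul_ne_zero (pow_ne_zero _ hlam0) hR0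
  have hKt : K ≠ ∞ := ENNReal.mul_ne_top (by finiteness) hR
  have hint : PanelSwap.handoverIntensity P Φ = K * 16 := by
    have h := hΦ.lintegral_handoversIn_eq hχ hχ_unif hindep MeasurableSet.univ
      (fun _ _ _ _ => trivial) (fun _ _ _ _ _ => by simp)
    rw [PanelSwap.angularWeight_univ, ← mul_assoc] at h
    rw [← h, PanelSwap.handoverIntensity]
    simp_rw [← PanelSwap.handovers_inter_eq]
  have hswap : ∀ m, PanelSwap.palmProb P Φ χ (PanelSwap.SwapAtOrigin m) =
      ENNReal.ofReal (2 ^ m / Real.pi * Real.sin (Real.pi / 2 ^ m)) := by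
    intro m
    have h := hΦ.lintegral_handoversIn_eq hχ hχ_unif hindep (PanelSwap.measurableSet_swapSet m)
      PanelSwap.swapSet_symm (fun _ u v c hr => PanelSwap.swapSet_scale hr u v c)
    rw [PanelSwap.angularWeight_swapSet, ← mul_assoc] at h
    rw [PanelSwap.palmProb, hint]
    simp_rw [PanelSwap.handovers_swap_eq]
    rw [h, ENNReal.mul_div_mul_left _ _ hK0 hKt, ENNReal.ofReal_mul (by norm_num),
      ENNReal.ofReal_ofNat, mul_comm, ENNReal.mul_div_cancel_right (by simp) (by simp)]
  refine ⟨?_, ?_, fun m _ => hswap m, ?_⟩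
  · rw [hint, pos_iff_ne_zero]
    exact mul_ne_zero hK0 (by simp)
  · rw [hint]
    exact ENNReal.mul_lt_top hKt.lt_top (by simp)
  · rw [hswap 1]
    simp
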